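/- **The overlay.** A $D^2$-tree of height $H\ge 0$ consists of a perfect binary tree of height $H$ and, for each of its $2^H$ leaves, a nonempty bucket of further nodes, of which that leaf is the representative. Level $\ell\le H$ consists of the $2^\ell$ tree nodes at depth $\ell$; the nodes of all the buckets, from left to right, form level $H+1$. Let $N$ be the total number of nodes (tree nodes and bucket nodes). Fix constants $a,b>0$ and assume that the buckets have size $\Theta(\log N)$ in the following sense: every bucket has at most $b\log N$ nodes, and the average bucket size is at least $a\log N$. The in-order sequence of the tree, with each bucket placed directly after its representative, is the order of the keys. Every tree node is linked to its father, its children and its in-order neighbours in the tree; a representative is linked to the first node of its bucket, and a bucket node to its representative and to its neighbours in the bucket. In addition there are links inside each level. Consider a level of $M$ nodes, numbered $0,\dots,M-1$, and put $L=\lceil\log_2 M\rceil$ (so $L=\ell$ if $M=2^\ell$). 1. *Routing tables.* Each node is linked to the nodes at distance $2^0,2^1,\dots,2^{L-1}$ to the left and to the right (as far as they exist). A horizontal search follows, at each step, the longest link that does not overshoot. 2. *Hypernodes.* The level is cut into hypernodes, consecutive groups of $s=\max(L,2)$ nodes with ranks $1,\dots,s$ from left to right (the last group may be incomplete). A node is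 linked to the nodes of neighbouring rank and to the node of highest rank in its hypernode (for an incomplete last hypernode: in the preceding one), and, if its rank is $i$, in both directions to the node at distance $2^i$ if this lies in the same hypernode, and otherwise to the node of rank $i$ (or the last node, if there are fewer than $i$) in the hypernode that contains the position at distance $2^i$. A horizontal search first goes to the node of highest rank; then, at a node outside the hypernode of its destination, it follows the exponential link of that node if this leads to another hypernode that is not beyond the one of the destination, and else goes to the next lower rank; in the hypernode of the destination it walks through neighbouring ranks. **Searches.** The search issued by a node $v$ at level $\ell$ for a target node $z$ has two phases. The horizontal phase moves inside level $\ell$ from $v$ to a node $u$: if $z$ is at level at least $\ell$, then $u$ is the node of level $\ell$ that is $z$ or an ancestor of $z$ (the ancestors of a bucket node being its representative and the ancestors of this one); if $z$ is an internal tree node above level $\ell$, then $u$ is the last node of level $\ell$ before $z$ if $v$ is before $z$, and the first node of level $\ell$ after $z$ if $v$ is after $z$; if $v$ is a bucket node and $z$ a leaf of the tree, then $u$ is the first node of the bucket of $z$. The vertical phase is empty if $u=z$. Otherwise, if $u$ is an internal tree node, the search first visits its two in-order neighbours in the tree and returns to $u$; then it moves along the tree (and along the list of a bucket) from $u$ up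 or down to $z$. **Congestion.** Each of the $N$ nodes issues one search; the $N$ targets are chosen independently and uniformly at random among all $N$ nodes. The congestion is the maximum over all nodes $x$ of the expected number of searches that visit $x$, divided by $N$. **Theorem.** For all $a,b>0$ there is a constant $C$ such that the following holds for every $D^2$-tree as above. * With routing tables: every node stores at most $C\log N$ links; every search proceeds along stored links from its source to its target; the expected number of searches whose horizontal phase visits a given node of level $\ell$ is at most $C(\ell+1)$; the expected number of searches whose vertical phase visits a given node is at most $C$; and the congestion is at most $C\,\frac{\log N}{N}$. * With hypernodes: every node stores at most $C$ links; every search proceeds along stored links from its source to its target; and the congestion is at most $C\,\frac{\log N}{N}$. -/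

import Mathlib

open scoped BigOperators

/-- A `D²`-tree overlay: a perfect binary tree of height `height`, whose `i`-th leaf (from the left,
`i < 2 ^ height`) is the representative of a nonempty bucket of `bucketSize i` further nodes,
arranged in a doubly linked list. The values `bucketSize i` with `2 ^ height ≤ i` are irrelevant. -/
structure D2Tree where
  height : ℕ
  bucketSize : ℕ → ℕ
  bucket_pos : ∀ i < 2 ^ height, 0 < bucketSize i

/-- The two ways of storing the links inside a level: full routing tables at every node, or
routing tables distributed over hypernodes. -/
inductive Routing where
  | table
  | hyper

/-! ### Routing inside one row of nodes

A row is a left-to-right sequence of `M` nodes, numbered `0, …, M - 1`. -/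

namespace Row

/-- The sequence of positions visited when `step` is applied from `c` on until `q` is reached
(at most `fuel` steps). -/
def follow (step : ℕ → ℕ) (q : ℕ) : ℕ → ℕ → List ℕ
  | 0, c => [c]
  | fuel + 1, c => if c = q then [c] else c :: follow step q fuel (step c)

/-- Routing table step from `c ≠ q` towards `q`: the longest link (its length is a power of two)
that does not overshoot. -/
def tableStep (q c : ℕ) : ℕ :=
  if c < q then c + 2 ^ Nat.log 2 (q - c) else c - 2 ^ Nat.log 2 (c - q)

/-- Size of a (complete) hypernode. A level `ℓ` has `2 ^ ℓ` nodes and `Nat.clog 2 (2 ^ ℓ) = ℓ`.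
(The two nodes of level `1` form one hypernode.) The hypernodes of a row are the consecutive groups
of this many nodes; the last one may be incomplete. -/
def hyperSize (M : ℕ) : ℕ := max (Nat.clog 2 M) 2

/-- The hypernode of position `c`. -/
def hyperOf (M c : ℕ) : ℕ := c / hyperSize M

/-- The rank `1, 2, …` of position `c` in its hypernode. -/
def rank (M c : ℕ) : ℕ := c % hyperSize M + 1

/-- The node of highest rank of the hypernode of `c`; the nodes of an incomplete last hypernode
use the one of the preceding hypernode. -/
def top (M c : ℕ) : ℕ :=
  if (hyperOf M c + 1) * hyperSize M ≤ M then (hyperOf M c + 1) * hyperSize M - 1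
  else if hyperOf M c = 0 then M - 1
  else hyperOf M c * hyperSize M - 1

/-- The hypernode which contains the position `2 ^ i` to the right of `c`, `i` the rank of `c`. -/
def rightHyper (M c : ℕ) : ℕ := hyperOf M (c + 2 ^ rank M c)

/-- The end point of the right link of `c`, of rank `i`: the node at distance `2 ^ i`, if it is in
the same hypernode; otherwise the node of rank `i` in the hypernode `rightHyper M c` (its last node
if that hypernode is incomplete and has fewer than `i` nodes). The link exists only if that
hypernode does, that is, if `rightHyper M c * hyperSize M < M`. -/
def rightEnd (M c : ℕ) : ℕ :=
  if rightHyper M c = hyperOf M c then c + 2 ^ rank M c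
  else min (rightHyper M c * hyperSize M + (rank M c - 1)) (M - 1)

/-- The hypernode which contains the position `2 ^ i` to the left of `c`, `i` the rank of `c`.
It is different from the one of `c`, as `i ≤ 2 ^ i`. -/
def leftHyper (M c : ℕ) : ℕ := hyperOf M (c - 2 ^ rank M c)

/-- The end point of the left link of `c`; the link exists only if `2 ^ rank M c ≤ c`. -/
def leftEnd (M c : ℕ) : ℕ := leftHyper M c * hyperSize M + (rank M c - 1)

/-- One step from `c ≠ q` towards `q` with hypernodes. In the hypernode of `q`, walk to the
neighbour in rank. Otherwise take the exponential link of `c` if it leads to another hypernode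
not beyond that of `q`, and go back to the next lower rank if not. -/
def hyperStep (M q c : ℕ) : ℕ :=
  if hyperOf M c = hyperOf M q then (if c < q then c + 1 else c - 1)
  else if hyperOf M c < hyperOf M q then
    (if hyperOf M c < rightHyper M c ∧ rightHyper M c ≤ hyperOf M q then rightEnd M c else c - 1)
  else
    (if 2 ^ rank M c ≤ c ∧ hyperOf M q ≤ leftHyper M c then leftEnd M c else c - 1)

/-- The horizontal search path from `p` to `q` in a row of `M` nodes. With hypernodes the search
first moves to the node of highest rank. (The numbers of steps allowed always suffice.) -/
def route : Routing → ℕ → ℕ → ℕ → List ℕ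
  | .table, M, p, q => follow (tableStep q) q M p
  | .hyper, M, p, q =>
    if p = q then [p]
    else if p = top M p then follow (hyperStep M q) q (4 * M + 4) p
    else p :: follow (hyperStep M q) q (4 * M + 4) (top M p)

/-- In a row of `M` nodes, the node at position `c` stores a link to the one at position `d`. -/
def Link : Routing → ℕ → ℕ → ℕ → Prop
  | .table, M, c, d => ∃ i < Nat.clog 2 M, d = c + 2 ^ i ∨ c = d + 2 ^ i
  | .hyper, M, c, d =>
    (hyperOf M c = hyperOf M d ∧ (d = c + 1 ∨ c = d + 1)) ∨ d = top M c ∨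
    (rightHyper M c * hyperSize M < M ∧ d = rightEnd M c) ∨
    (2 ^ rank M c ≤ c ∧ d = leftEnd M c)

end Row

namespace D2Tree

variable (T : D2Tree)

/-- Number of bucket nodes in the buckets to the left of the `i`-th one. -/
def offset (i : ℕ) : ℕ := ∑ j ∈ Finset.range i, T.bucketSize j

/-- Number of nodes of row `r`. Row `r ≤ height` is level `r` of the perfect binary tree; row
`height + 1` consists of the nodes of all the buckets, from left to right. -/
def width (r : ℕ) : ℕ := if r ≤ T.height then 2 ^ r else T.offset (2 ^ T.height)

/-- The nodes, as pairs (row, position in the row). -/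
def nodes : Finset (ℕ × ℕ) :=
  (Finset.range (T.height + 2)).biUnion fun r => (Finset.range (T.width r)).image (Prod.mk r)

/-- The total number `N` of nodes. -/
def N : ℕ := T.nodes.card

/-- The bucket that contains the bucket node at position `q`. -/
def bucketOf (q : ℕ) : ℕ := Nat.findGreatest (fun i => T.offset i ≤ q) (2 ^ T.height)

/-- Bucket sizes are `O(log N)`, and `Ω(log N)` on average. -/
def Balanced (a b : ℝ) : Prop :=
  (∀ i < 2 ^ T.height, (T.bucketSize i : ℝ) ≤ b * Real.log T.N) ∧
  a * Real.log T.N * 2 ^ T.height ≤ T.offset (2 ^ T.height)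

/-- The leaf before (in order) an internal node `u` of the perfect binary tree. -/
def leftLeaf (u : ℕ × ℕ) : ℕ × ℕ :=
  (T.height, u.2 * 2 ^ (T.height - u.1) + 2 ^ (T.height - u.1 - 1) - 1)

/-- The leaf after (in order) an internal node `u` of the perfect binary tree. -/
def rightLeaf (u : ℕ × ℕ) : ℕ × ℕ :=
  (T.height, u.2 * 2 ^ (T.height - u.1) + 2 ^ (T.height - u.1 - 1))

/-- The links `x → y` kept in both variants: to the two children and the father, to the in-order
neighbours in the perfect binary tree, from a representative to the first node of its bucket, from
a bucket node to its representative, and between neighbours in a bucket. -/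
def VerticalLink (x y : ℕ × ℕ) : Prop :=
  (x.1 < T.height ∧ y.1 = x.1 + 1 ∧ y.2 / 2 = x.2) ∨
  (y.1 < T.height ∧ x.1 = y.1 + 1 ∧ x.2 / 2 = y.2) ∨
  (x.1 < T.height ∧ (y = T.leftLeaf x ∨ y = T.rightLeaf x)) ∨
  (y.1 < T.height ∧ (x = T.leftLeaf y ∨ x = T.rightLeaf y)) ∨
  (x.1 = T.height ∧ y = (T.height + 1, T.offset x.2)) ∨
  (x.1 = T.height + 1 ∧ y = (T.height, T.bucketOf x.2)) ∨
  (x.1 = T.height + 1 ∧ y.1 = T.height + 1 ∧ T.bucketOf x.2 = T.bucketOf y.2 ∧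
    (y.2 = x.2 + 1 ∨ x.2 = y.2 + 1))

/-- Node `x` stores a link to node `y`. -/
def Link (k : Routing) (x y : ℕ × ℕ) : Prop :=
  x ∈ T.nodes ∧ y ∈ T.nodes ∧
    (T.VerticalLink x y ∨ (x.1 = y.1 ∧ Row.Link k (T.width x.1) x.2 y.2))

/-- The space used by a node: the number of links that it stores. -/
noncomputable def space (k : Routing) (x : ℕ × ℕ) : ℕ := {y | T.Link k x y}.ncard

/-- Position of the ancestor in row `r ≤ z.1` of `z` (of `z` itself if `r = z.1`); the ancestors of
a bucket node are the representative and its ancestors. -/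
def ancestor (z : ℕ × ℕ) (r : ℕ) : ℕ :=
  if r = z.1 then z.2
  else if z.1 ≤ T.height then z.2 / 2 ^ (z.1 - r)
  else T.bucketOf z.2 / 2 ^ (T.height - r)

/-- Position in row `r > z.1` of the first descendant of the right child of `z`, for an internal
node `z`. The position before is that of the last descendant of the left child of `z`. -/
def middle (z : ℕ × ℕ) (r : ℕ) : ℕ :=
  if r ≤ T.height then z.2 * 2 ^ (r - z.1) + 2 ^ (r - z.1 - 1)
  else T.offset (z.2 * 2 ^ (T.height - z.1) + 2 ^ (T.height - z.1 - 1))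

/-- The position in the row of `v` where the horizontal phase of the search from `v` for `z` stops.
If `z` is not above this row, it is that of the ancestor of `z`. If `z` is an internal node above
the row, it is the last position before `z` (in order) if `v` is before `z`, and the first
position after `z` if `v` is after `z`. If `v` is a bucket node and `z` a representative, it is the
first node of the bucket of `z`. In any case `z` is an ancestor or a descendant of the node
reached, or equal to it. -/
def haltPos (v z : ℕ × ℕ) : ℕ :=
  if v.1 ≤ z.1 then T.ancestor z v.1
  else if z.1 < T.height then
    (if v.2 < T.middle z v.1 then T.middle z v.1 - 1 else T.middle z v.1)
  else T.offset z.2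

/-- The node where the horizontal phase stops. -/
def haltNode (v z : ℕ × ℕ) : ℕ × ℕ := (v.1, T.haltPos v z)

/-- The horizontal phase of the search from `v` for `z`: the list of the nodes visited. -/
def horizontal (k : Routing) (v z : ℕ × ℕ) : List (ℕ × ℕ) :=
  (Row.route k (T.width v.1) v.2 (T.haltPos v z)).map (Prod.mk v.1)

/-- The path in the perfect binary tree from its node `u` to the ancestor of `u` in row `r`. -/
def climb (u : ℕ × ℕ) (r : ℕ) : List (ℕ × ℕ) :=
  (List.range (u.1 - r + 1)).map fun j => (u.1 - j, u.2 / 2 ^ j)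

/-- The path from `u` up to its ancestor in row `r < u.1`; a bucket node continues with its
representative. -/
def ascend (u : ℕ × ℕ) (r : ℕ) : List (ℕ × ℕ) :=
  if u.1 ≤ T.height then climb u r else u :: climb (T.height, T.bucketOf u.2) r

/-- The path from the ancestor in row `r` of `z` down to `z`; a bucket node is reached from its
representative along the linked list of the bucket. -/
def descend (r : ℕ) (z : ℕ × ℕ) : List (ℕ × ℕ) :=
  if z.1 ≤ T.height then (climb z r).reverse
  else (climb (T.height, T.bucketOf z.2) r).reverse ++
    (List.range (z.2 - T.offset (T.bucketOf z.2) + 1)).map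
      fun j => (T.height + 1, T.offset (T.bucketOf z.2) + j)

/-- The vertical phase from `u` to `z`, an ancestor or a descendant of `u`: the list of the nodes
visited. At an internal node `u ≠ z` the search first looks at the in-order neighbours of `u`, in
order to decide on the direction. -/
def verticalFrom (u z : ℕ × ℕ) : List (ℕ × ℕ) :=
  if u = z then [u]
  else (if u.1 < T.height then [u, T.leftLeaf u, u, T.rightLeaf u] else []) ++
    (if u.1 < z.1 then T.descend u.1 z else T.ascend u z.1)

/-- The vertical phase of the search from `v` for `z`. -/
def vertical (v z : ℕ × ℕ) : List (ℕ × ℕ) := T.verticalFrom (T.haltNode v z) z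

/-- The list of the nodes visited by the search from `v` for `z`. -/
def search (k : Routing) (v z : ℕ × ℕ) : List (ℕ × ℕ) :=
  T.horizontal k v z ++ (T.vertical v z).tail

/-- `l` is a path from `v` to `z` along stored links. -/
def IsPath (k : Routing) (v z : ℕ × ℕ) (l : List (ℕ × ℕ)) : Prop :=
  l.head? = some v ∧ l.getLast? = some z ∧ l.IsChain (T.Link k)

/-- Every node `v` issues one search, for a target `t v`. If the targets are chosen independently
and uniformly at random among all the nodes, that is, if `t` is uniformly distributed among all the
maps from nodes to nodes, this is the expected number of searches (or phases of searches) that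
visit the node `x`. -/
noncomputable def expectedVisits (path : ℕ × ℕ → ℕ × ℕ → List (ℕ × ℕ)) (x : ℕ × ℕ) : ℝ :=
  𝔼 t : T.nodes → T.nodes,
    ((Finset.univ.filter fun v : T.nodes => x ∈ path v (t v)).card : ℝ)

/-- The congestion: the maximum over all nodes of the expected number of searches that visit the
node, divided by the total number `N` of searches. -/
noncomputable def congestion (k : Routing) : ℝ :=
  ⨆ x : T.nodes, T.expectedVisits (T.search k) x / T.N

end D2Tree

/-! By linearity of expectation and uniformity of the targets, the expected number of visits to `x`
is the number of pairs (source, target) whose path visits `x`, divided by `N` (`expectedVisits_eq`).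
The theorem thus becomes a matter of counting pairs.

Horizontal phase. Buckets have at most b log N nodes and, by the bound on the average, 2^H log N ≤
N/a; hence a subtree rooted in row r has O(N/2^r) nodes. Besides the nodes of such a subtree, only a
bounded number of targets above the row can make a search halt at a given position. So in a row of
width M each position serves O(N/M) targets (`Balanced.card_haltTargets_mul_le`), and it suffices
that only O(M log M) of the M² routes inside the row (up to lower order terms) pass a given position
c. With routing tables, routes are translation invariant: a route through c is known from its
direction, its displacement and which of its logarithmically many vertices is c. With hypernodes of
size s, a link at rank i passes a number of hypernodes that depends on i only, so the search makes
change greedily. Coin values at most double plus one from rank to rank, so once the total distance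
is known, the distance left at a given rank has at most three possible values
(`GreedyState.exists_eq`). Hence c, one of O(M/s) distances and a bounded choice give the hypernodes
of both ends; the places inside these cost a factor s², in total O(Ms).

Vertical phase. A tree node of row r on a descent is an ancestor of the target or the target itself:
fewer than 2^(r+1) sources at or above row r meet O(N/2^r) targets. An ascent starts next to its
target in in-order, so each tree node strictly below the target on it lies at the boundary between
the two subtrees of the target and determines it up to two choices (`middle_inj`). Halting nodes and
their in-order neighbours are covered by the count of halting targets.

Finally N ≤ 2^H · O(log N) forces log N = O(H+1), which turns the bound for the bucket row into one
in terms of its level. -/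

/-! ### Walks -/

/-- `l` lists the vertices of a walk from `a` to `b` along the relation `R`. -/
def IsWalk {α : Type*} (R : α → α → Prop) (a b : α) (l : List α) : Prop :=
  l.head? = some a ∧ l.getLast? = some b ∧ l.IsChain R

namespace IsWalk

variable {α β : Type*} {R : α → α → Prop} {a b c d : α} {l l' : List α}

theorem singleton (a : α) : IsWalk R a a [a] := ⟨rfl, rfl, .singleton _⟩

theorem append (h : IsWalk R a b l) (h' : IsWalk R c d l') (hbc : R b c) :
    IsWalk R a d (l ++ l') := by
  obtain ⟨h1, h2, h3⟩ := h
  obtain ⟨k1, k2, k3⟩ := h'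
  refine ⟨by simp [h1], by simp [k2], List.isChain_append.2 ⟨h3, k3, ?_⟩⟩
  rw [h2, k1]
  rintro x ⟨⟩ y ⟨⟩
  exact hbc

theorem cons (hab : R a b) (h : IsWalk R b c l) : IsWalk R a c (a :: l) :=
  (singleton a).append h hab

theorem glue (h : IsWalk R a b l) (h' : IsWalk R b c l') : IsWalk R a c (l ++ l'.tail) := by
  obtain ⟨k1, k2, k3⟩ := h'
  match l', k1, k2, k3 with
  | [x], k1, k2, k3 =>
    simp only [List.head?_cons, Option.some.injEq, List.getLast?_singleton] at k1 k2
    subst k1; subst k2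
    simpa using h
  | x :: y :: t, k1, k2, k3 =>
    simp only [List.head?_cons, Option.some.injEq] at k1
    subst k1
    rw [List.isChain_cons_cons] at k3
    refine h.append ⟨rfl, ?_, k3.2⟩ k3.1
    simpa using k2

theorem reverse (h : IsWalk R a b l) (hR : ∀ x y, R x y → R y x) : IsWalk R b a l.reverse := by
  obtain ⟨h1, h2, h3⟩ := h
  refine ⟨by simpa using h2, by simpa using h1, List.isChain_reverse.2 (h3.imp fun x y => hR x y)⟩

theorem map {S : β → β → Prop} (f : α → β) (h : IsWalk R a b l)
    (hf : ∀ x y, R x y → S (f x) (f y)) : IsWalk S (f a) (f b) (l.map f) := by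
  obtain ⟨h1, h2, h3⟩ := h
  exact ⟨by simp [h1], by simp [h2], (List.isChain_map f).2 (h3.imp hf)⟩

theorem map_range (f : ℕ → α) (n : ℕ) (hf : ∀ j < n, R (f j) (f (j + 1))) :
    IsWalk R (f 0) (f n) ((List.range (n + 1)).map f) := by
  refine ⟨by simp [List.range_succ_eq_map], by simp [List.range_succ], ?_⟩
  rw [List.isChain_map, List.isChain_range]
  exact fun m hm => hf m (by omega)

end IsWalk

namespace Row

/-! ### Following a step function -/

section follow

variable {step : ℕ → ℕ} {q : ℕ} {P : ℕ → Prop}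

theorem mem_follow (hP : ∀ c, P c → c ≠ q → P (step c)) {fuel c : ℕ} (hc : P c) {x : ℕ}
    (hx : x ∈ follow step q fuel c) : P x := by
  induction fuel generalizing c with
  | zero => rw [follow, List.mem_singleton] at hx; exact hx ▸ hc
  | succ n ih =>
    rw [follow] at hx
    split_ifs at hx with h
    · rw [List.mem_singleton] at hx; exact hx ▸ hc
    · rcases List.mem_cons.1 hx with rfl | hx
      · exact hc
      · exact ih (hP c hc h) hx

/-- The measure drops at every step before `q`, so fuel at least the initial measure cannot run out
early. The invariant `P` restricts attention to reachable positions. -/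
theorem follow_isWalk {R : ℕ → ℕ → Prop} (μ : ℕ → ℕ) (hP : ∀ c, P c → c ≠ q → P (step c))
    (hμ : ∀ c, P c → c ≠ q → μ (step c) < μ c) (hR : ∀ c, P c → c ≠ q → R c (step c))
    {fuel c : ℕ} (hc : P c) (hfuel : μ c ≤ fuel) : IsWalk R c q (follow step q fuel c) := by
  induction fuel generalizing c with
  | zero =>
    have : c = q := by
      by_contra h
      have := hμ c hc h
      omega
    subst this
    exact IsWalk.singleton _
  | succ n ih =>
    rw [follow]
    split_ifs with h
    · subst h; exact IsWalk.singleton _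
    · have := hμ c hc h
      exact IsWalk.cons (hR c hc h) (ih (hP c hc h) (by omega))

end follow

/-! ### Routing tables -/

theorem tableStep_add (q c d : ℕ) (h : c ≠ q) :
    tableStep (q + d) (c + d) = tableStep q c + d := by
  unfold tableStep
  simp only [add_lt_add_iff_right, Nat.add_sub_add_right]
  split_ifs with h1
  · omega
  · have := Nat.pow_log_le_self 2 (x := c - q) (by omega)
    omega

/-- Translation invariance of table routes, on which their count rests: every route is a shift of
one that starts or ends at 0. -/
theorem follow_tableStep_add (q d fuel c : ℕ) :
    follow (tableStep (q + d)) (q + d) fuel (c + d) =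
      (follow (tableStep q) q fuel c).map (· + d) := by
  induction fuel generalizing c with
  | zero => simp [follow]
  | succ n ih =>
    simp only [follow, add_left_inj]
    split_ifs with h
    · simp
    · simp [tableStep_add q c d h, ih]

/-- A step deletes the leading binary digit of the remaining distance. -/
theorem dist_tableStep {q c : ℕ} (h : c ≠ q) :
    Nat.dist (tableStep q c) q < 2 ^ Nat.log 2 (Nat.dist c q) ∧
      Nat.dist (tableStep q c) q + 2 ^ Nat.log 2 (Nat.dist c q) = Nat.dist c q := by
  unfold tableStep Nat.dist
  split_ifs with h1
  · have e : c - q + (q - c) = q - c := by omega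
    rw [e]
    have h2 := Nat.pow_log_le_self 2 (x := q - c) (by omega)
    have h3 := Nat.lt_pow_succ_log_self (b := 2) (by norm_num) (q - c)
    rw [pow_succ] at h3
    omega
  · have e : c - q + (q - c) = c - q := by omega
    rw [e]
    have h2 := Nat.pow_log_le_self 2 (x := c - q) (by omega)
    have h3 := Nat.lt_pow_succ_log_self (b := 2) (by norm_num) (c - q)
    rw [pow_succ] at h3
    omega

theorem length_follow_tableStep {q fuel c k : ℕ} (h : Nat.dist c q < 2 ^ k) :
    (follow (tableStep q) q fuel c).length ≤ k + 1 := by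
  induction fuel generalizing c k with
  | zero => simp [follow]
  | succ n ih =>
    rw [follow]
    split_ifs with hc
    · simp
    · have hd : Nat.dist c q ≠ 0 := fun h0 => hc (Nat.eq_of_dist_eq_zero h0)
      have hk : Nat.log 2 (Nat.dist c q) < k := Nat.log_lt_of_lt_pow hd h
      have h2 := ih (dist_tableStep hc).1
      rw [List.length_cons]
      omega

theorem tableStep_lt {M q c : ℕ} (hq : q < M) (hc : c < M) : tableStep q c < M := by
  unfold tableStep
  split_ifs with h1
  · have h2 := Nat.pow_log_le_self 2 (x := q - c) (by omega)
    omega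
  · exact (Nat.sub_le _ _).trans_lt hc

theorem link_tableStep {M q c : ℕ} (hq : q < M) (hc : c < M) (h : c ≠ q) :
    Link .table M c (tableStep q c) := by
  unfold tableStep
  split_ifs with h1
  · have h2 := Nat.pow_log_le_self 2 (x := q - c) (by omega)
    exact ⟨_, (Nat.lt_clog_iff_pow_lt (by norm_num)).2 (by omega), Or.inl rfl⟩
  · have h2 := Nat.pow_log_le_self 2 (x := c - q) (by omega)
    exact ⟨Nat.log 2 (c - q), (Nat.lt_clog_iff_pow_lt (by norm_num)).2 (by omega), Or.inr (by omega)⟩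

theorem route_table_isWalk {M p q : ℕ} (hp : p < M) (hq : q < M) :
    IsWalk (fun c d => c < M ∧ d < M ∧ Link .table M c d) p q (route .table M p q) := by
  refine follow_isWalk (P := (· < M)) (fun c => Nat.dist c q) (fun c hc _ => tableStep_lt hq hc)
    (fun c hc h => ?_) (fun c hc h => ⟨hc, tableStep_lt hq hc, link_tableStep hq hc h⟩) hp ?_
  · have := (dist_tableStep h).2
    have := Nat.one_le_two_pow (n := Nat.log 2 (Nat.dist c q))
    show Nat.dist _ _ < Nat.dist _ _
    omega
  · show Nat.dist _ _ ≤ _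
    unfold Nat.dist
    omega

/-- The number of pairs of source and destination in a row for which the search visits `c`. -/
def routeCount (k : Routing) (M c : ℕ) : ℕ :=
  ((Finset.range M ×ˢ Finset.range M).filter fun pq => c ∈ route k M pq.1 pq.2).card

/-- For each direction there are at most M displacements, each with at most `Nat.clog 2 M + 1`
vertices that can be the one lying at c; displacement and vertex recover both ends. -/
theorem routeCount_table_le (M c : ℕ) : routeCount .table M c ≤ 2 * (M * (Nat.clog 2 M + 1)) := by
  -- `A` holds the routes to the right, with x the distance of c from the source; `B` those to the
  -- left, with x the distance of c from the destination.
  let A : Finset (ℕ × ℕ) := (Finset.range M).biUnion fun t =>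
    (follow (tableStep t) t M 0).toFinset.image fun x => (c - x, c - x + t)
  let B : Finset (ℕ × ℕ) := (Finset.range M).biUnion fun t =>
    (follow (tableStep 0) 0 M t).toFinset.image fun x => (c - x + t, c - x)
  have hlen : ∀ p q, p < M → q < M →
      (follow (tableStep q) q M p).length ≤ Nat.clog 2 M + 1 := fun p q hp hq => by
    refine length_follow_tableStep (lt_of_lt_of_le ?_ (Nat.le_pow_clog (by norm_num) M))
    unfold Nat.dist
    omega
  have hA : A.card ≤ M * (Nat.clog 2 M + 1) := by
    refine (Finset.card_biUnion_le_card_mul _ _ (Nat.clog 2 M + 1) fun t ht => ?_).trans (by simp)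
    rw [Finset.mem_range] at ht
    exact Finset.card_image_le.trans ((List.toFinset_card_le _).trans (hlen _ _ (by omega) ht))
  have hB : B.card ≤ M * (Nat.clog 2 M + 1) := by
    refine (Finset.card_biUnion_le_card_mul _ _ (Nat.clog 2 M + 1) fun t ht => ?_).trans (by simp)
    rw [Finset.mem_range] at ht
    exact Finset.card_image_le.trans ((List.toFinset_card_le _).trans (hlen _ _ ht (by omega)))
  have hsub : ((Finset.range M ×ˢ Finset.range M).filter
      fun pq => c ∈ route .table M pq.1 pq.2) ⊆ A ∪ B := by
    intro pq h
    obtain ⟨p, q⟩ := pq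
    rw [Finset.mem_filter, Finset.mem_product, Finset.mem_range, Finset.mem_range] at h
    obtain ⟨⟨hp, hq⟩, h⟩ := h
    simp only [route] at hp hq h
    rw [Finset.mem_union]
    rcases le_total p q with hpq | hpq
    · left
      have e := follow_tableStep_add (q - p) p M 0
      rw [zero_add, Nat.sub_add_cancel hpq] at e
      rw [e, List.mem_map] at h
      obtain ⟨x, hx, rfl⟩ := h
      refine Finset.mem_biUnion.2 ⟨q - p, Finset.mem_range.2 (by omega), ?_⟩
      refine Finset.mem_image.2 ⟨x, List.mem_toFinset.2 hx, ?_⟩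
      rw [Prod.mk.injEq]
      omega
    · right
      have e := follow_tableStep_add 0 q M (p - q)
      rw [zero_add, Nat.sub_add_cancel hpq] at e
      rw [e, List.mem_map] at h
      obtain ⟨x, hx, rfl⟩ := h
      refine Finset.mem_biUnion.2 ⟨p - q, Finset.mem_range.2 (by omega), ?_⟩
      refine Finset.mem_image.2 ⟨x, List.mem_toFinset.2 hx, ?_⟩
      rw [Prod.mk.injEq]
      omega
  have := (Finset.card_le_card hsub).trans (Finset.card_union_le A B)
  unfold routeCount
  omega

end Row

namespace Row

/-! ### Greedy change making

In units of hypernodes the exponential link at rank `i` is a coin whose value depends on `i` only,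
and the search with hypernodes makes change greedily, from the highest rank downwards. -/

/-- Coin values `e 1, …, e s` for which greedy change making uses every coin at most twice. -/
structure CoinSystem (e : ℕ → ℕ) (s : ℕ) : Prop where
  one_le : 1 ≤ s
  first : e 1 ≤ 1
  next : ∀ i, 1 ≤ i → i < s → e (i + 1) ≤ 2 * e i + 1
  last : 1 ≤ e s

/-- What remains of the amount `t` modulo the coins of index `s, s - 1, …, s - k`, in turn. -/
def resid (e : ℕ → ℕ) (s t : ℕ) : ℕ → ℕ
  | 0 => t % e s
  | k + 1 => resid e s t k % e (s - (k + 1))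

/-- The greedy algorithm started with the amount `t` may be at coin `i` with `d` left to pay. -/
def GreedyState (e : ℕ → ℕ) (s t i d : ℕ) : Prop :=
  1 ≤ i ∧ i ≤ s ∧ 1 ≤ e i ∧ d ≤ 2 * e i ∧ d % e i = resid e s t (s - i)

section greedy

variable {e : ℕ → ℕ} {s t i d : ℕ}

/-- An amount up to the largest coin suffices because the hypernodes are large enough for that coin
to span the row, see `le_rightCoin` and `le_leftCoin`. -/
theorem CoinSystem.start (he : CoinSystem e s) (ht : t ≤ e s) : GreedyState e s t s t :=
  ⟨he.one_le, le_rfl, he.last, by omega, by rw [Nat.sub_self]; rfl⟩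

theorem GreedyState.pay (h : GreedyState e s t i d) (hd : e i ≤ d) :
    GreedyState e s t i (d - e i) := by
  obtain ⟨h1, h2, h3, h4, h5⟩ := h
  exact ⟨h1, h2, h3, by omega, by rw [← h5, Nat.mod_eq_sub_mod hd]⟩

/-- If 0 < d < e i then e i ≥ 2, so i is not 1, and e i ≤ 2 e (i-1) + 1 gives both e (i-1) ≥ 1 and d
≤ e i - 1 ≤ 2 e (i-1). The strict inequality is what makes room for the +1 in `CoinSystem.next`. -/
theorem GreedyState.lower (he : CoinSystem e s) (h : GreedyState e s t i d) (h0 : 0 < d)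
    (hd : d < e i) : 2 ≤ i ∧ GreedyState e s t (i - 1) d := by
  obtain ⟨h1, h2, h3, h4, h5⟩ := h
  have hi : i ≠ 1 := by
    rintro rfl
    have := he.first
    omega
  obtain ⟨j, rfl⟩ : ∃ j, i = j + 1 := ⟨i - 1, by omega⟩
  have hn := he.next j (by omega) (by omega)
  have hj : s - j = s - (j + 1) + 1 := by omega
  rw [Nat.add_sub_cancel]
  refine ⟨by omega, by omega, by omega, by omega, by omega, ?_⟩
  rw [hj, resid, ← h5, Nat.mod_eq_of_lt hd]
  congr 2
  omega

/-- The residue modulo the current coin is fixed by the initial amount and the rank; only the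
quotient, at most 2, is free. -/
theorem GreedyState.exists_eq (h : GreedyState e s t i d) :
    ∃ k < 3, d = resid e s t (s - i) + e i * k := by
  obtain ⟨-, -, h3, h4, h5⟩ := h
  refine ⟨d / e i, ?_, by rw [← h5, Nat.mod_add_div]⟩
  rw [Nat.div_lt_iff_lt_mul h3]
  omega

end greedy

/-- Number of hypernodes passed by the right link of a node of rank `i`. -/
def rightCoin (s i : ℕ) : ℕ := (i + 2 ^ i - 1) / s

/-- Number of hypernodes passed by the left link of a node of rank `i`. -/
def leftCoin (s i : ℕ) : ℕ := (2 ^ i + s - i) / s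

/-- The numerators n = i + 2^i - 1 satisfy n' ≤ 2n + 1, and n < s(k+1) then gives n' < 2s(k+1), so
the +1 survives the floor. The lower bound s ≥ 2 is what makes the first coin at most 1, here and
for `leftCoin`. -/
theorem rightCoin_system {s : ℕ} (hs : 2 ≤ s) : CoinSystem (rightCoin s) s where
  one_le := by omega
  first := by
    rw [rightCoin, Nat.div_le_iff_le_mul_add_pred (by omega)]
    omega
  next i hi _ := by
    unfold rightCoin
    have h := Nat.lt_mul_div_succ (i + 2 ^ i - 1) (by omega : 0 < s)
    refine Nat.le_of_lt_succ ((Nat.div_lt_iff_lt_mul (by omega)).2 ?_)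
    set k := (i + 2 ^ i - 1) / s
    have e : (2 * k + 1).succ * s = 2 * (s * (k + 1)) := by rw [Nat.succ_eq_add_one]; ring
    rw [e, pow_succ]
    omega
  last := by
    rw [rightCoin, Nat.one_le_div_iff (by omega)]
    have := Nat.one_le_two_pow (n := s)
    omega

theorem leftCoin_system {s : ℕ} (hs : 2 ≤ s) : CoinSystem (leftCoin s) s where
  one_le := by omega
  first := by
    rw [leftCoin, Nat.div_le_iff_le_mul_add_pred (by omega)]
    omega
  next i hi his := by
    unfold leftCoin
    have h := Nat.lt_mul_div_succ (2 ^ i + s - i) (by omega : 0 < s)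
    refine Nat.le_of_lt_succ ((Nat.div_lt_iff_lt_mul (by omega)).2 ?_)
    set k := (2 ^ i + s - i) / s
    have e : (2 * k + 1).succ * s = 2 * (s * (k + 1)) := by rw [Nat.succ_eq_add_one]; ring
    rw [e, pow_succ]
    omega
  last := by
    rw [leftCoin, Nat.one_le_div_iff (by omega)]
    have := Nat.lt_two_pow_self (n := s)
    omega

/-- Since M ≤ 2^s, the coin of the highest rank is worth at least any distance in the row; this is
why a search begins at a node of highest rank. -/
theorem le_rightCoin {s M t : ℕ} (hs : 2 ≤ s) (hM : M ≤ 2 ^ s) (ht : t ≤ (M - 1) / s) :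
    t ≤ rightCoin s s := ht.trans (Nat.div_le_div_right (by omega))

theorem le_leftCoin {s M t : ℕ} (hM : M ≤ 2 ^ s) (ht : t ≤ (M - 1) / s) :
    t ≤ leftCoin s s := ht.trans (Nat.div_le_div_right (by omega))

/-! ### Hypernodes -/

theorem two_le_hyperSize (M : ℕ) : 2 ≤ hyperSize M := le_max_right _ _

theorem le_two_pow_hyperSize (M : ℕ) : M ≤ 2 ^ hyperSize M :=
  (Nat.le_pow_clog (by norm_num) M).trans (Nat.pow_le_pow_right (by norm_num) (le_max_left _ _))

theorem hyperSize_le {M : ℕ} (hM : 2 ≤ M) : hyperSize M ≤ M :=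
  max_le (Nat.clog_le_of_le_pow Nat.lt_two_pow_self.le) hM

theorem hyperOf_mul_add (M h : ℕ) {j : ℕ} (hj : j < hyperSize M) :
    hyperOf M (h * hyperSize M + j) = h := by
  rw [hyperOf, Nat.add_comm, Nat.add_mul_div_right _ _ (by omega), Nat.div_eq_of_lt hj, zero_add]

theorem rank_mul_add (M h : ℕ) {j : ℕ} (hj : j < hyperSize M) :
    rank M (h * hyperSize M + j) = j + 1 := by
  rw [rank, Nat.add_comm (h * _), Nat.add_mul_mod_self_right, Nat.mod_eq_of_lt hj]

theorem eq_hyperOf_rank (M c : ℕ) : ∃ j, rank M c = j + 1 ∧ j < hyperSize M ∧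
    c = hyperOf M c * hyperSize M + j := by
  have := two_le_hyperSize M
  refine ⟨c % hyperSize M, rfl, Nat.mod_lt _ (by omega), ?_⟩
  rw [hyperOf, Nat.mul_comm, Nat.div_add_mod]

theorem hyperOf_eq_of_bounds {M c h : ℕ} (h1 : h * hyperSize M ≤ c)
    (h2 : c < h * hyperSize M + hyperSize M) : hyperOf M c = h := by
  obtain ⟨j, rfl⟩ := Nat.exists_eq_add_of_le h1
  exact hyperOf_mul_add M h (by omega)

theorem hyperOf_le {M c : ℕ} (hc : c < M) : hyperOf M c ≤ (M - 1) / hyperSize M :=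
  Nat.div_le_div_right (by omega)

theorem hyperOf_rank_pred {M c : ℕ} (h : 2 ≤ rank M c) :
    hyperOf M (c - 1) = hyperOf M c ∧ rank M (c - 1) = rank M c - 1 := by
  obtain ⟨j, h1, h2, h3⟩ := eq_hyperOf_rank M c
  have e : c - 1 = hyperOf M c * hyperSize M + (j - 1) := by omega
  rw [e, hyperOf_mul_add _ _ (by omega), rank_mul_add _ _ (by omega)]
  omega

theorem rightHyper_eq (M c : ℕ) :
    rightHyper M c = hyperOf M c + rightCoin (hyperSize M) (rank M c) := by
  obtain ⟨j, h1, h2, h3⟩ := eq_hyperOf_rank M c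
  have := Nat.one_le_two_pow (n := rank M c)
  have e : c + 2 ^ rank M c = (rank M c + 2 ^ rank M c - 1) + hyperOf M c * hyperSize M := by
    omega
  unfold rightHyper
  rw [e, hyperOf, Nat.add_mul_div_right _ _ (by omega), rightCoin, Nat.add_comm]

/-- With c = hs + (i-1), `leftCoin` is the ceiling of (2^i - (i-1))/s, which is at most h exactly
when 2^i ≤ c. A missing left link can thus be treated like a coin that is too large. -/
theorem leftLink_iff (M c : ℕ) :
    2 ^ rank M c ≤ c ↔ leftCoin (hyperSize M) (rank M c) ≤ hyperOf M c := by
  obtain ⟨j, h1, h2, h3⟩ := eq_hyperOf_rank M c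
  have := Nat.lt_two_pow_self (n := rank M c)
  rw [leftCoin, ← Nat.lt_succ_iff (n := hyperOf M c), Nat.div_lt_iff_lt_mul (by omega), Nat.succ_mul]
  omega

theorem leftHyper_eq {M c : ℕ} (h : 2 ^ rank M c ≤ c) :
    leftHyper M c = hyperOf M c - leftCoin (hyperSize M) (rank M c) := by
  have hk := (leftLink_iff M c).1 h
  obtain ⟨j, h1, h2, h3⟩ := eq_hyperOf_rank M c
  have := Nat.lt_two_pow_self (n := rank M c)
  have d1 := Nat.div_mul_le_self (2 ^ rank M c + hyperSize M - rank M c) (hyperSize M)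
  have d2 := Nat.lt_mul_div_succ (2 ^ rank M c + hyperSize M - rank M c)
    (by omega : 0 < hyperSize M)
  change leftCoin (hyperSize M) (rank M c) * hyperSize M ≤ _ at d1
  change _ < hyperSize M * (leftCoin (hyperSize M) (rank M c) + 1) at d2
  rw [Nat.mul_add_one, Nat.mul_comm (hyperSize M)] at d2
  have d3 := Nat.mul_le_mul_right (hyperSize M) hk
  refine hyperOf_eq_of_bounds ?_ ?_ <;> rw [Nat.sub_mul] <;> omega

/-- The first hypernode is complete because `hyperSize M ≤ M`, so the fallback `M - 1` of `top`
never occurs. The shift by one hypernode comes from sources in an incomplete last hypernode. -/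
theorem top_spec {M p : ℕ} (hM : 2 ≤ M) (hp : p < M) :
    top M p < M ∧ rank M (top M p) = hyperSize M ∧
      (hyperOf M p = hyperOf M (top M p) ∨ hyperOf M p = hyperOf M (top M p) + 1) := by
  have hs := two_le_hyperSize M
  have hsM := hyperSize_le hM
  obtain ⟨j, h1, h2, h3⟩ := eq_hyperOf_rank M p
  unfold top
  split_ifs with h h'
  · have e : (hyperOf M p + 1) * hyperSize M - 1 =
        hyperOf M p * hyperSize M + (hyperSize M - 1) := by
      rw [Nat.add_one_mul]; omega
    rw [e, hyperOf_mul_add _ _ (by omega), rank_mul_add _ _ (by omega)]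
    rw [Nat.add_one_mul] at h
    omega
  · rw [h'] at h
    omega
  · obtain ⟨k, hk⟩ : ∃ k, hyperOf M p = k + 1 := ⟨hyperOf M p - 1, by omega⟩
    rw [hk, Nat.add_one_mul] at h3 ⊢
    have e : k * hyperSize M + hyperSize M - 1 = k * hyperSize M + (hyperSize M - 1) := by
      omega
    rw [e, hyperOf_mul_add _ _ (by omega), rank_mul_add _ _ (by omega)]
    omega

/-! ### Invariant and termination of the search with hypernodes -/

/-- The positions which a search with hypernodes for `q` may reach, if its first node of highest
rank is in the hypernode `g`. -/
def HyperState (M q g c : ℕ) : Prop :=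
  c < M ∧ (hyperOf M c = hyperOf M q ∨
    (hyperOf M c < hyperOf M q ∧ g ≤ hyperOf M q ∧ GreedyState (rightCoin (hyperSize M)) (hyperSize M)
      (hyperOf M q - g) (rank M c) (hyperOf M q - hyperOf M c)) ∨
    (hyperOf M q < hyperOf M c ∧ hyperOf M q ≤ g ∧ GreedyState (leftCoin (hyperSize M)) (hyperSize M)
      (g - hyperOf M q) (rank M c) (hyperOf M c - hyperOf M q)))

theorem hyperState_top {M p q : ℕ} (hM : 2 ≤ M) (hp : p < M) (hq : q < M) :
    HyperState M q (hyperOf M (top M p)) (top M p) := by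
  obtain ⟨h1, h2, -⟩ := top_spec hM hp
  have hs := two_le_hyperSize M
  have b1 := hyperOf_le h1
  have b2 := hyperOf_le hq
  refine ⟨h1, ?_⟩
  rw [h2]
  rcases lt_trichotomy (hyperOf M (top M p)) (hyperOf M q) with h | h | h
  · exact Or.inr (Or.inl ⟨h, h.le, (rightCoin_system hs).start
      (le_rightCoin hs (le_two_pow_hyperSize M) (by omega))⟩)
  · exact Or.inl h
  · exact Or.inr (Or.inr ⟨h, h.le, (leftCoin_system hs).start
      (le_leftCoin (le_two_pow_hyperSize M) (by omega))⟩)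

/-- An upper bound for the number of steps that remain from `c` to `q`. -/
def hyperMeasure (M q c : ℕ) : ℕ :=
  if hyperOf M c = hyperOf M q then Nat.dist c q
  else Nat.dist (hyperOf M c) (hyperOf M q) + rank M c + hyperSize M

theorem dist_lt_of_hyperOf_eq {M c d : ℕ} (h : hyperOf M c = hyperOf M d) :
    Nat.dist c d < hyperSize M := by
  obtain ⟨j, h1, h2, h3⟩ := eq_hyperOf_rank M c
  obtain ⟨k, k1, k2, k3⟩ := eq_hyperOf_rank M d
  rw [← h] at k3
  unfold Nat.dist
  omega

/-- The summand `hyperSize M` in the measure pays for the final walk: entering the hypernode of `q`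
leaves a distance smaller than it. Only then may a jump change the rank, by truncation in an
incomplete hypernode. -/
theorem hyperMeasure_lt_of_jump {M q c d : ℕ} (hc : hyperOf M c ≠ hyperOf M q)
    (hd : Nat.dist (hyperOf M d) (hyperOf M q) < Nat.dist (hyperOf M c) (hyperOf M q))
    (hr : hyperOf M d ≠ hyperOf M q → rank M d = rank M c) :
    hyperMeasure M q d < hyperMeasure M q c := by
  unfold hyperMeasure
  rw [if_neg hc]
  split_ifs with h
  · have := dist_lt_of_hyperOf_eq h
    omega
  · rw [hr h]
    omega

theorem hyperMeasure_lt_of_pred {M q c : ℕ} (hc : hyperOf M c ≠ hyperOf M q)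
    (h : 2 ≤ rank M c) : hyperMeasure M q (c - 1) < hyperMeasure M q c := by
  obtain ⟨h1, h2⟩ := hyperOf_rank_pred h
  unfold hyperMeasure
  rw [h1, if_neg hc, if_neg hc, h2]
  omega

theorem hyperMeasure_le {M q c : ℕ} (hM : 2 ≤ M) (hc : c < M) (hq : q < M) :
    hyperMeasure M q c ≤ 4 * M + 4 := by
  have hsM := hyperSize_le hM
  have h1 : hyperOf M c ≤ c := Nat.div_le_self _ _
  have h2 : hyperOf M q ≤ q := Nat.div_le_self _ _
  obtain ⟨j, h3, h4, -⟩ := eq_hyperOf_rank M c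
  unfold hyperMeasure Nat.dist
  split_ifs <;> omega

theorem link_pred {M c : ℕ} (h : 2 ≤ rank M c) : Link .hyper M c (c - 1) := by
  obtain ⟨j, h1, h2, h3⟩ := eq_hyperOf_rank M c
  exact Or.inl ⟨(hyperOf_rank_pred h).1.symm, Or.inr (by omega)⟩

/-- Outside the hypernode of `q`, taking a link is `GreedyState.pay` and going down one rank is
`GreedyState.lower`; inside it, the search just walks. -/
theorem hyperStep_spec {M q g c : ℕ} (hq : q < M) (h : HyperState M q g c) (hne : c ≠ q) :
    HyperState M q g (hyperStep M q c) ∧ hyperMeasure M q (hyperStep M q c) < hyperMeasure M q c ∧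
      Link .hyper M c (hyperStep M q c) := by
  have hs := two_le_hyperSize M
  obtain ⟨j, hj1, hj2, hj3⟩ := eq_hyperOf_rank M c
  obtain ⟨k, hk1, hk2, hk3⟩ := eq_hyperOf_rank M q
  obtain ⟨hcM, hcq | ⟨hlt, hg, hst⟩ | ⟨hlt, hg, hst⟩⟩ := h
  · have key : ∀ d, (d = c + 1 ∧ c < q) ∨ (c = d + 1 ∧ q < c) → HyperState M q g d ∧
        hyperMeasure M q d < hyperMeasure M q c ∧ Link .hyper M c d := by
      intro d hd
      rw [hcq] at hj3
      have hdq : hyperOf M d = hyperOf M q := hyperOf_eq_of_bounds (by omega) (by omega)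
      refine ⟨⟨by omega, Or.inl hdq⟩, ?_, Or.inl ⟨by omega, by omega⟩⟩
      unfold hyperMeasure
      rw [if_pos hdq, if_pos hcq]
      unfold Nat.dist
      omega
    unfold hyperStep
    rw [if_pos hcq]
    apply key
    split_ifs <;> omega
  · unfold hyperStep
    rw [if_neg hlt.ne, if_pos hlt]
    split_ifs with hcond
    · obtain ⟨hc1, hc2⟩ := hcond
      have hR := rightHyper_eq M c
      have hmul := Nat.mul_le_mul_right (hyperSize M) hc2
      have hend : rightEnd M c = min (rightHyper M c * hyperSize M + j) (M - 1) := by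
        rw [rightEnd, if_neg hc1.ne', hj1, Nat.add_sub_cancel]
      have hof : hyperOf M (rightEnd M c) = rightHyper M c := by
        rw [hend]
        exact hyperOf_eq_of_bounds (by omega) (by omega)
      -- A hypernode strictly before that of `q` is complete, so the minimum in `rightEnd` is not
      -- attained by `M - 1` alone and the rank is kept.
      have hrank : rightHyper M c < hyperOf M q → rank M (rightEnd M c) = rank M c := by
        intro h'
        have h2 := Nat.mul_le_mul_right (hyperSize M) (Nat.succ_le_of_lt h')
        rw [Nat.succ_mul] at h2
        rw [hend, min_eq_left (by omega), rank_mul_add _ _ hj2, hj1]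
      refine ⟨⟨by omega, ?_⟩, hyperMeasure_lt_of_jump hlt.ne ?_ ?_, ?_⟩
      · rcases hc2.eq_or_lt with h' | h'
        · exact Or.inl (by rw [hof, h'])
        · right; left
          refine ⟨by omega, hg, ?_⟩
          rw [hrank h', hof, hR, ← Nat.sub_sub]
          exact hst.pay (by omega)
      · rw [hof]
        unfold Nat.dist
        omega
      · intro h'
        exact hrank (by omega)
      · exact Or.inr (Or.inr (Or.inl ⟨by omega, rfl⟩))
    · rw [rightHyper_eq] at hcond
      -- The coin is at least 1, so the link does leave the hypernode; its refusal can only mean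
      -- that it overshoots.
      have h1 := hst.2.2.1
      obtain ⟨h2, hst'⟩ := hst.lower (rightCoin_system hs) (by omega) (by omega)
      obtain ⟨h3, h4⟩ := hyperOf_rank_pred h2
      refine ⟨⟨by omega, Or.inr (Or.inl ?_)⟩, hyperMeasure_lt_of_pred hlt.ne h2, link_pred h2⟩
      rw [h3, h4]
      exact ⟨hlt, hg, hst'⟩
  · unfold hyperStep
    rw [if_neg hlt.ne', if_neg (by omega)]
    split_ifs with hcond
    · obtain ⟨hc1, hc2⟩ := hcond
      have hL := leftHyper_eq hc1
      have hle := (leftLink_iff M c).1 hc1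
      have hpos := hst.2.2.1
      have hend : leftEnd M c = leftHyper M c * hyperSize M + j := by
        rw [leftEnd, hj1, Nat.add_sub_cancel]
      have hof : hyperOf M (leftEnd M c) = leftHyper M c := by
        rw [hend, hyperOf_mul_add _ _ hj2]
      have hrank : rank M (leftEnd M c) = rank M c := by
        rw [hend, rank_mul_add _ _ hj2, hj1]
      have hmul := Nat.mul_le_mul_right (hyperSize M) (by omega : leftHyper M c ≤ hyperOf M c)
      refine ⟨⟨by omega, ?_⟩, hyperMeasure_lt_of_jump hlt.ne' ?_ fun _ => hrank, ?_⟩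
      · rcases hc2.eq_or_lt with h' | h'
        · exact Or.inl (by rw [hof, h'])
        · right; right
          refine ⟨by omega, hg, ?_⟩
          rw [hrank, hof, hL, Nat.sub_right_comm]
          exact hst.pay (by omega)
      · rw [hof]
        unfold Nat.dist
        omega
      · exact Or.inr (Or.inr (Or.inr ⟨hc1, rfl⟩))
    · have hd : hyperOf M c - hyperOf M q < leftCoin (hyperSize M) (rank M c) := by
        by_contra h'
        have h1 := (leftLink_iff M c).2 (by omega)
        exact hcond ⟨h1, by rw [leftHyper_eq h1]; omega⟩
      obtain ⟨h2, hst'⟩ := hst.lower (leftCoin_system hs) (by omega) hd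
      obtain ⟨h3, h4⟩ := hyperOf_rank_pred h2
      refine ⟨⟨by omega, Or.inr (Or.inr ?_)⟩, hyperMeasure_lt_of_pred hlt.ne' h2, link_pred h2⟩
      rw [h3, h4]
      exact ⟨hlt, hg, hst'⟩

theorem route_hyper_isWalk {M p q : ℕ} (hp : p < M) (hq : q < M) :
    IsWalk (fun c d => c < M ∧ d < M ∧ Link .hyper M c d) p q (route .hyper M p q) := by
  simp only [route]
  split_ifs with h h'
  · subst h; exact IsWalk.singleton _
  all_goals
    have hM : 2 ≤ M := by omega
    have hst := hyperState_top hM hp hq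
    have hw : IsWalk (fun c d => c < M ∧ d < M ∧ Link .hyper M c d) (top M p) q
        (follow (hyperStep M q) q (4 * M + 4) (top M p)) :=
      follow_isWalk (hyperMeasure M q) (fun c hc hne => (hyperStep_spec hq hc hne).1)
        (fun c hc hne => (hyperStep_spec hq hc hne).2.1)
        (fun c hc hne => ⟨hc.1, (hyperStep_spec hq hc hne).1.1, (hyperStep_spec hq hc hne).2.2⟩)
        hst (hyperMeasure_le hM hst.1 hq)
  · rwa [← h'] at hw
  · exact IsWalk.cons ⟨hp, hst.1, Or.inr (Or.inl rfl)⟩ hw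

/-! ### Counting the routes with hypernodes through a position -/

theorem mem_route_hyper {M p q c : ℕ} (hM : 2 ≤ M) (hp : p < M) (hq : q < M)
    (hc : c ∈ route .hyper M p q) : c = p ∨ HyperState M q (hyperOf M (top M p)) c := by
  have hmem : c ∈ follow (hyperStep M q) q (4 * M + 4) (top M p) →
      HyperState M q (hyperOf M (top M p)) c :=
    mem_follow (fun c hc hne => (hyperStep_spec hq hc hne).1) (hyperState_top hM hp hq)
  simp only [route] at hc
  split_ifs at hc with h h'
  · exact Or.inl (List.mem_singleton.1 hc)
  · exact Or.inr (hmem (by rwa [← h']))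
  · exact (List.mem_cons.1 hc).imp_right hmem

/-- The routes through c are those with source c (M of them), those with destination in the
hypernode of c (at most Ms), and those passing c greedily to the right or left (at most 12Ms each);
with M ≤ Ms this gives 26. -/
theorem routeCount_hyper_le (M c : ℕ) :
    routeCount .hyper M c ≤ 26 * (M * (Nat.clog 2 M + 2)) := by
  rcases Nat.lt_or_ge M 2 with hM | hM
  · refine (Finset.card_filter_le _ _).trans ?_
    rw [Finset.card_product, Finset.card_range]
    nlinarith [Nat.zero_le (M * Nat.clog 2 M)]
  set s := hyperSize M with hs_def
  have hs := two_le_hyperSize M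
  have hsM := hyperSize_le hM
  rw [← hs_def] at hs hsM
  -- A code consists of the total distance in hypernodes, the quotient by the current coin, the
  -- places of source and destination inside their hypernodes, and a bit telling whether the source
  -- lies one hypernode after its top node. `fR` and `fL` decode it, with g the hypernode of the
  -- destination.
  let I := Finset.range (M / s + 1) ×ˢ Finset.range 3 ×ˢ Finset.range s ×ˢ Finset.range s ×ˢ
    Finset.range 2
  let fR : ℕ × ℕ × ℕ × ℕ × ℕ → ℕ × ℕ := fun y =>
    let g := hyperOf M c +
      (resid (rightCoin s) s y.1 (s - rank M c) + rightCoin s (rank M c) * y.2.1)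
    ((g - y.1 + y.2.2.2.2) * s + y.2.2.1, g * s + y.2.2.2.1)
  let fL : ℕ × ℕ × ℕ × ℕ × ℕ → ℕ × ℕ := fun y =>
    let g := hyperOf M c -
      (resid (leftCoin s) s y.1 (s - rank M c) + leftCoin s (rank M c) * y.2.1)
    ((g + y.1 + y.2.2.2.2) * s + y.2.2.1, g * s + y.2.2.2.1)
  have hsub : ((Finset.range M ×ˢ Finset.range M).filter
      fun pq => c ∈ route .hyper M pq.1 pq.2) ⊆
      ((Finset.range M).image fun q => (c, q)) ∪
      ((Finset.range M ×ˢ Finset.range s).image fun y => (y.1, hyperOf M c * s + y.2)) ∪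
      I.image fR ∪ I.image fL := by
    intro pq h
    obtain ⟨p, q⟩ := pq
    rw [Finset.mem_filter, Finset.mem_product, Finset.mem_range, Finset.mem_range] at h
    obtain ⟨⟨hp, hq⟩, h⟩ := h
    simp only at hp hq h
    obtain ⟨α, -, hα, ep⟩ := eq_hyperOf_rank M p
    obtain ⟨β, -, hβ, eq⟩ := eq_hyperOf_rank M q
    rw [← hs_def] at hα hβ ep eq
    simp only [Finset.mem_union]
    rcases mem_route_hyper hM hp hq h with rfl | ⟨hcM, hst⟩
    · exact Or.inl (Or.inl (Or.inl (Finset.mem_image.2 ⟨q, Finset.mem_range.2 hq, rfl⟩)))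
    obtain ⟨ht1, -, ht3⟩ := top_spec hM hp
    have b1 := hyperOf_le ht1
    have b2 := hyperOf_le hq
    have b3 : (M - 1) / s ≤ M / s := Nat.div_le_div_right (by omega)
    rw [← hs_def] at b1 b2 hst
    obtain ⟨φ, hφ, eφ⟩ : ∃ φ < 2, hyperOf M p = hyperOf M (top M p) + φ := by
      rcases ht3 with h' | h'
      exacts [⟨0, by omega, h'⟩, ⟨1, by omega, h'⟩]
    rcases hst with h' | ⟨hlt, hg, hst⟩ | ⟨hlt, hg, hst⟩
    · refine Or.inl (Or.inl (Or.inr (Finset.mem_image.2 ⟨(p, β), ?_, ?_⟩)))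
      · exact Finset.mem_product.2 ⟨Finset.mem_range.2 hp, Finset.mem_range.2 hβ⟩
      · rw [h', ← eq]
    · obtain ⟨k, hk, ek⟩ := hst.exists_eq
      refine Or.inl (Or.inr (Finset.mem_image.2
        ⟨(hyperOf M q - hyperOf M (top M p), k, α, β, φ), ?_, ?_⟩))
      · simp only [I, Finset.mem_product, Finset.mem_range]
        omega
      · simp only [fR, ← ek]
        rw [show hyperOf M c + (hyperOf M q - hyperOf M c) = hyperOf M q by omega,
          show hyperOf M q - (hyperOf M q - hyperOf M (top M p)) + φ = hyperOf M p by omega,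
          ← ep, ← eq]
    · obtain ⟨k, hk, ek⟩ := hst.exists_eq
      refine Or.inr (Finset.mem_image.2
        ⟨(hyperOf M (top M p) - hyperOf M q, k, α, β, φ), ?_, ?_⟩)
      · simp only [I, Finset.mem_product, Finset.mem_range]
        omega
      · simp only [fL, ← ek]
        rw [show hyperOf M c - (hyperOf M c - hyperOf M q) = hyperOf M q by omega,
          show hyperOf M q + (hyperOf M (top M p) - hyperOf M q) + φ = hyperOf M p by omega,
          ← ep, ← eq]
  have hI : I.card = (M / s + 1) * (3 * (s * (s * 2))) := by
    simp only [I, Finset.card_product, Finset.card_range]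
  have hIle : I.card ≤ 12 * (M * s) := by
    have h1 : M / s * s ≤ M := Nat.div_mul_le_self M s
    rw [hI]
    calc (M / s + 1) * (3 * (s * (s * 2))) = 6 * ((M / s * s + s) * s) := by ring
      _ ≤ 6 * ((M + M) * s) := by gcongr
      _ = 12 * (M * s) := by ring
  have hfin := (Finset.card_le_card hsub).trans <| (Finset.card_union_le _ _).trans <|
    add_le_add ((Finset.card_union_le _ _).trans (add_le_add ((Finset.card_union_le _ _).trans
      (add_le_add Finset.card_image_le Finset.card_image_le)) Finset.card_image_le))
      Finset.card_image_le
  rw [Finset.card_product, Finset.card_range, Finset.card_range] at hfin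
  have hs2 : s ≤ Nat.clog 2 M + 2 := max_le (by omega) (by omega)
  have hMs : M * s ≤ M * (Nat.clog 2 M + 2) := Nat.mul_le_mul_left M hs2
  have : M ≤ M * s := Nat.le_mul_of_pos_right M (by omega)
  unfold routeCount
  omega

end Row

theorem IsWalk.imp {α : Type*} {R S : α → α → Prop} {a b : α} {l : List α} (h : IsWalk R a b l)
    (hRS : ∀ x y, R x y → S x y) : IsWalk S a b l := ⟨h.1, h.2.1, h.2.2.imp hRS⟩

namespace D2Tree

variable (T : D2Tree)

/-! ### Rows and buckets -/

theorem width_of_le {r : ℕ} (h : r ≤ T.height) : T.width r = 2 ^ r := if_pos h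

theorem width_bucket : T.width (T.height + 1) = T.offset (2 ^ T.height) := if_neg (by omega)

theorem mem_nodes {x : ℕ × ℕ} : x ∈ T.nodes ↔ x.1 < T.height + 2 ∧ x.2 < T.width x.1 := by
  obtain ⟨r, c⟩ := x
  simp only [nodes, Finset.mem_biUnion, Finset.mem_image, Finset.mem_range, Prod.mk.injEq]
  constructor
  · rintro ⟨r', h1, c', h2, rfl, rfl⟩
    exact ⟨h1, h2⟩
  · rintro ⟨h1, h2⟩
    exact ⟨r, h1, c, h2, rfl, rfl⟩

theorem mem_nodes_of_le {r c : ℕ} (hr : r ≤ T.height) : (r, c) ∈ T.nodes ↔ c < 2 ^ r := by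
  rw [mem_nodes, T.width_of_le hr]
  exact and_iff_right (by simp only; omega)

theorem mem_nodes_bucket {c : ℕ} :
    (T.height + 1, c) ∈ T.nodes ↔ c < T.offset (2 ^ T.height) := by
  rw [mem_nodes, T.width_bucket]
  exact and_iff_right (by simp only; omega)

theorem row_cases {x : ℕ × ℕ} (hx : x ∈ T.nodes) : x.1 ≤ T.height ∨ x.1 = T.height + 1 := by
  have := (T.mem_nodes.1 hx).1
  omega

theorem offset_succ (i : ℕ) : T.offset (i + 1) = T.offset i + T.bucketSize i :=
  Finset.sum_range_succ _ _

theorem offset_mono : Monotone T.offset :=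
  monotone_nat_of_le_succ fun i => by rw [T.offset_succ]; omega

theorem offset_lt_offset_succ {i : ℕ} (hi : i < 2 ^ T.height) : T.offset i < T.offset (i + 1) := by
  have := T.bucket_pos i hi
  rw [T.offset_succ]
  omega

theorem offset_lt_offset {i j : ℕ} (hij : i < j) (hj : j ≤ 2 ^ T.height) :
    T.offset i < T.offset j :=
  (T.offset_lt_offset_succ (by omega)).trans_le (T.offset_mono hij)

theorem offset_inj {i j : ℕ} (hi : i ≤ 2 ^ T.height) (hj : j ≤ 2 ^ T.height)
    (h : T.offset i = T.offset j) : i = j := by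
  rcases lt_trichotomy i j with h' | h' | h'
  · have := T.offset_lt_offset h' hj
    omega
  · exact h'
  · have := T.offset_lt_offset h' hi
    omega

theorem le_offset {i : ℕ} (hi : i ≤ 2 ^ T.height) : i ≤ T.offset i := by
  induction i with
  | zero => omega
  | succ n ih =>
    have := ih (by omega)
    have := T.offset_lt_offset_succ (i := n) (by omega)
    omega

theorem bucketOf_eq {i q : ℕ} (hi : i < 2 ^ T.height) (h1 : T.offset i ≤ q)
    (h2 : q < T.offset (i + 1)) : T.bucketOf q = i := by
  unfold bucketOf
  rw [Nat.findGreatest_eq_iff]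
  refine ⟨hi.le, fun _ => h1, fun n hn _ h => ?_⟩
  have := T.offset_mono (Nat.succ_le_of_lt hn)
  simp only [Nat.succ_eq_add_one] at this
  omega

theorem bucketOf_spec {q : ℕ} (hq : q < T.offset (2 ^ T.height)) :
    T.bucketOf q < 2 ^ T.height ∧ T.offset (T.bucketOf q) ≤ q ∧
      q < T.offset (T.bucketOf q + 1) := by
  have h1 : T.offset (T.bucketOf q) ≤ q :=
    Nat.findGreatest_spec (P := fun i => T.offset i ≤ q) (Nat.zero_le _) (by simp [offset])
  have h2 : T.bucketOf q ≤ 2 ^ T.height := Nat.findGreatest_le _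
  have h3 : T.bucketOf q < 2 ^ T.height := by
    refine lt_of_le_of_ne h2 fun h => ?_
    rw [h] at h1
    omega
  refine ⟨h3, h1, ?_⟩
  by_contra h
  exact Nat.findGreatest_is_greatest (P := fun i => T.offset i ≤ q) (n := 2 ^ T.height)
    (k := T.bucketOf q + 1) (Nat.lt_succ_self _) (by omega) (by omega)

theorem bucketOf_offset {i : ℕ} (hi : i < 2 ^ T.height) : T.bucketOf (T.offset i) = i :=
  T.bucketOf_eq hi le_rfl (T.offset_lt_offset_succ hi)

theorem bucketOf_offset_pred {i : ℕ} (h0 : 0 < i) (hi : i ≤ 2 ^ T.height) :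
    T.bucketOf (T.offset i - 1) = i - 1 := by
  obtain ⟨j, rfl⟩ : ∃ j, i = j + 1 := ⟨i - 1, by omega⟩
  have := T.offset_lt_offset_succ (i := j) (by omega)
  rw [Nat.add_sub_cancel]
  exact T.bucketOf_eq (by omega) (by omega) (by omega)

/-! ### Ancestors -/

theorem ancestor_of_le {z : ℕ × ℕ} {r : ℕ} (hz : z.1 ≤ T.height) :
    T.ancestor z r = z.2 / 2 ^ (z.1 - r) := by
  unfold ancestor
  split_ifs with h
  · simp [h]
  · rfl

theorem ancestor_bucket {z : ℕ × ℕ} {r : ℕ} (hz : z.1 = T.height + 1) (hr : r ≤ T.height) :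
    T.ancestor z r = T.bucketOf z.2 / 2 ^ (T.height - r) := by
  unfold ancestor
  rw [if_neg (by omega), if_neg (by omega)]

theorem ancestor_self (z : ℕ × ℕ) : T.ancestor z z.1 = z.2 := if_pos rfl

theorem div_two_pow_lt {c r r' : ℕ} (hr : r ≤ r') (hc : c < 2 ^ r') : c / 2 ^ (r' - r) < 2 ^ r := by
  rw [Nat.div_lt_iff_lt_mul (by positivity), ← pow_add]
  rwa [Nat.add_sub_cancel' hr]

theorem ancestor_lt {z : ℕ × ℕ} {r : ℕ} (hz : z ∈ T.nodes) (hr : r ≤ z.1) :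
    T.ancestor z r < T.width r := by
  obtain ⟨-, h2⟩ := T.mem_nodes.1 hz
  rcases T.row_cases hz with h | h
  · rw [T.ancestor_of_le h, T.width_of_le (hr.trans h)]
    rw [T.width_of_le h] at h2
    exact div_two_pow_lt hr h2
  · rcases hr.eq_or_lt with rfl | hr
    · rwa [ancestor_self]
    · rw [h, T.width_bucket] at h2
      rw [T.ancestor_bucket h (by omega), T.width_of_le (by omega)]
      exact div_two_pow_lt (by omega) (T.bucketOf_spec h2).1

/-! ### The nodes next to an internal node in a lower row -/

theorem middle_of_le {z : ℕ × ℕ} {r : ℕ} (hr : r ≤ T.height) (hz : z.1 < r) :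
    T.middle z r = 2 ^ (r - z.1 - 1) * (2 * z.2 + 1) := by
  obtain ⟨d, hd⟩ : ∃ d, r - z.1 = d + 1 := ⟨r - z.1 - 1, by omega⟩
  rw [middle, if_pos hr, hd, Nat.add_sub_cancel, pow_succ]
  ring

theorem middle_bucket (z : ℕ × ℕ) :
    T.middle z (T.height + 1) = T.offset (T.middle z T.height) := by
  unfold middle
  rw [if_neg (by omega), if_pos le_rfl]

theorem middle_mul {z : ℕ × ℕ} {ρ r : ℕ} (hz : z.1 < ρ) (hρ : ρ ≤ r) (hr : r ≤ T.height) :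
    T.middle z r = T.middle z ρ * 2 ^ (r - ρ) := by
  rw [T.middle_of_le hr (by omega), T.middle_of_le (by omega) hz,
    show r - z.1 - 1 = (ρ - z.1 - 1) + (r - ρ) by omega, pow_add]
  ring

theorem middle_pos {z : ℕ × ℕ} {r : ℕ} (hr : r ≤ T.height) (hz : z.1 < r) : 0 < T.middle z r := by
  rw [T.middle_of_le hr hz]
  positivity

theorem middle_lt {z : ℕ × ℕ} {r : ℕ} (hz : z ∈ T.nodes) (hr : r ≤ T.height) (hzr : z.1 < r) :
    T.middle z r < 2 ^ r := by
  have h2 := (T.mem_nodes.1 hz).2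
  rw [T.width_of_le (by omega)] at h2
  rw [T.middle_of_le hr hzr]
  have e : 2 ^ r = 2 ^ (r - z.1 - 1) * (2 * 2 ^ z.1) := by
    rw [← pow_succ', ← pow_add]
    congr 1
    omega
  rw [e]
  exact Nat.mul_lt_mul_of_pos_left (by omega) (by positivity)

theorem odd_decomposition_unique {i j m n : ℕ} (h : 2 ^ i * (2 * m + 1) = 2 ^ j * (2 * n + 1)) :
    i = j ∧ m = n := by
  induction i generalizing j with
  | zero =>
    cases j with
    | zero => simp at h; omega
    | succ j => rw [pow_succ', pow_zero, mul_assoc] at h; omega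
  | succ i ih =>
    cases j with
    | zero => rw [pow_succ', pow_zero, mul_assoc] at h; omega
    | succ j =>
      rw [pow_succ', pow_succ', mul_assoc, mul_assoc] at h
      have := ih (j := j) (by omega)
      omega

/-- The boundary below z is a power of two times an odd number (`middle_of_le`); the exponent gives
the row of z and the odd factor its position. -/
theorem middle_inj {z z' : ℕ × ℕ} {r : ℕ} (hr : r ≤ T.height) (hz : z.1 < r) (hz' : z'.1 < r)
    (h : T.middle z r = T.middle z' r) : z = z' := by
  rw [T.middle_of_le hr hz, T.middle_of_le hr hz'] at h
  obtain ⟨h1, h2⟩ := odd_decomposition_unique h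
  exact Prod.ext (by omega) h2

theorem pred_mul_div {m d : ℕ} (hm : 0 < m) (hd : 0 < d) : (m * d - 1) / d = m - 1 := by
  obtain ⟨k, rfl⟩ : ∃ k, m = k + 1 := ⟨m - 1, by omega⟩
  rw [Nat.add_one_mul, Nat.add_sub_assoc (by omega), Nat.mul_comm, Nat.mul_add_div hd,
    Nat.div_eq_of_lt (by omega)]
  omega

/-- In the row just below z the boundary separates its two children; the two positions beside a
lower boundary descend from these. -/
theorem middle_div {z : ℕ × ℕ} {r c : ℕ} (hr : r ≤ T.height) (hz : z.1 < r)
    (hc : c = T.middle z r - 1 ∨ c = T.middle z r) : c / 2 ^ (r - z.1) = z.2 := by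
  have h : c / 2 ^ (r - (z.1 + 1)) / 2 = z.2 := by
    have hp := T.middle_pos (z := z) (r := z.1 + 1) (by omega) (by omega)
    have hm := T.middle_mul (z := z) (ρ := z.1 + 1) (r := r) (by omega) (by omega) hr
    have he := T.middle_of_le (z := z) (r := z.1 + 1) (by omega) (by omega)
    simp only [Nat.add_sub_cancel_left, Nat.sub_self, pow_zero, one_mul] at he
    rcases hc with rfl | rfl
    · rw [hm, pred_mul_div hp (by positivity)]
      omega
    · rw [hm, Nat.mul_div_cancel _ (by positivity)]
      omega
  rw [← h, Nat.div_div_eq_div_mul, ← pow_succ]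
  congr 2
  omega

/-! ### The end of the horizontal phase -/

theorem haltPos_of_le {v z : ℕ × ℕ} (h : v.1 ≤ z.1) : T.haltPos v z = T.ancestor z v.1 := if_pos h

theorem haltPos_internal {v z : ℕ × ℕ} (h : z.1 < v.1) (hz : z.1 < T.height) :
    T.haltPos v z = T.middle z v.1 - 1 ∨ T.haltPos v z = T.middle z v.1 := by
  unfold haltPos
  rw [if_neg (by omega), if_pos hz]
  split_ifs
  exacts [Or.inl rfl, Or.inr rfl]

theorem haltPos_leaf {v z : ℕ × ℕ} (h : z.1 < v.1) (hz : z.1 = T.height) :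
    T.haltPos v z = T.offset z.2 := by
  unfold haltPos
  rw [if_neg (by omega), if_neg (by omega)]

theorem haltPos_lt {v z : ℕ × ℕ} (hv : v ∈ T.nodes) (hz : z ∈ T.nodes) :
    T.haltPos v z < T.width v.1 := by
  rcases le_or_gt v.1 z.1 with h | h
  · rw [T.haltPos_of_le h]
    exact T.ancestor_lt hz h
  have hv1 := T.row_cases hv
  rcases lt_or_ge z.1 T.height with hz1 | hz1
  · suffices h' : T.middle z v.1 < T.width v.1 by
      have := T.haltPos_internal h hz1
      omega
    rcases hv1 with hv1 | hv1
    · rw [T.width_of_le hv1]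
      exact T.middle_lt hz hv1 h
    · rw [hv1, T.width_bucket, T.middle_bucket]
      exact T.offset_lt_offset (T.middle_lt hz le_rfl hz1) le_rfl
  · have hz2 : z.1 = T.height := by omega
    have h2 := (T.mem_nodes.1 hz).2
    rw [hz2, T.width_of_le le_rfl] at h2
    rw [T.haltPos_leaf h hz2, show v.1 = T.height + 1 by omega, T.width_bucket]
    exact T.offset_lt_offset h2 le_rfl

theorem haltNode_mem {v z : ℕ × ℕ} (hv : v ∈ T.nodes) (hz : z ∈ T.nodes) :
    T.haltNode v z ∈ T.nodes :=
  T.mem_nodes.2 ⟨(T.mem_nodes.1 hv).1, T.haltPos_lt hv hz⟩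

/-- The ancestors of the halting node below an internal target are the nodes next to the target. -/
theorem ancestor_haltNode {v z : ℕ × ℕ} {ρ : ℕ} (hv : v ∈ T.nodes) (hz : z ∈ T.nodes)
    (hzH : z.1 < T.height) (hzρ : z.1 < ρ) (hρ : ρ ≤ T.height) (hρv : ρ ≤ v.1) :
    T.ancestor (T.haltNode v z) ρ = T.middle z ρ - 1 ∨
      T.ancestor (T.haltNode v z) ρ = T.middle z ρ := by
  have hh := T.haltPos_internal (by omega : z.1 < v.1) hzH
  have hp := T.middle_pos hρ hzρ
  rcases T.row_cases hv with hv1 | hv1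
  · rw [T.ancestor_of_le (z := T.haltNode v z) hv1]
    change T.haltPos v z / 2 ^ (v.1 - ρ) = _ ∨ T.haltPos v z / 2 ^ (v.1 - ρ) = _
    rw [T.middle_mul hzρ hρv hv1] at hh
    rcases hh with hh | hh
    · left; rw [hh, pred_mul_div hp (by positivity)]
    · right; rw [hh, Nat.mul_div_cancel _ (by positivity)]
  · rw [T.ancestor_bucket (z := T.haltNode v z) hv1 hρ]
    change T.bucketOf (T.haltPos v z) / _ = _ ∨ T.bucketOf (T.haltPos v z) / _ = _
    rw [hv1, T.middle_bucket] at hh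
    have hlt := T.middle_lt hz le_rfl hzH
    have hp' := T.middle_pos le_rfl hzH
    rcases hh with hh | hh
    · left
      rw [hh, T.bucketOf_offset_pred hp' hlt.le, T.middle_mul hzρ hρ le_rfl,
        pred_mul_div hp (by positivity)]
    · right
      rw [hh, T.bucketOf_offset hlt, T.middle_mul hzρ hρ le_rfl,
        Nat.mul_div_cancel _ (by positivity)]

/-- This makes the ascent end at its target. From the bucket row one passes first to the leaf row,
where an internal target has its two in-order neighbours. -/
theorem ancestor_haltNode_target {v z : ℕ × ℕ} (hv : v ∈ T.nodes) (hz : z ∈ T.nodes)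
    (h : z.1 < v.1) : T.ancestor (T.haltNode v z) z.1 = z.2 := by
  have hv1 := T.row_cases hv
  rcases lt_or_ge z.1 T.height with hzH | hzH
  · rcases hv1 with hv1 | hv1
    · rw [T.ancestor_of_le (z := T.haltNode v z) hv1]
      exact T.middle_div hv1 h (T.haltPos_internal h hzH)
    · have h1 := T.ancestor_haltNode hv hz hzH hzH le_rfl (by omega)
      rw [T.ancestor_bucket (z := T.haltNode v z) hv1 le_rfl, Nat.sub_self, pow_zero,
        Nat.div_one] at h1
      rw [T.ancestor_bucket (z := T.haltNode v z) hv1 hzH.le]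
      exact T.middle_div le_rfl hzH h1
  · have hz2 : z.1 = T.height := by omega
    have h2 := (T.mem_nodes.1 hz).2
    rw [hz2, T.width_of_le le_rfl] at h2
    rw [T.ancestor_bucket (z := T.haltNode v z) (by simp only [haltNode]; omega) (by omega), hz2,
      Nat.sub_self, pow_zero, Nat.div_one]
    change T.bucketOf (T.haltPos v z) = _
    rw [T.haltPos_leaf h hz2, T.bucketOf_offset h2]

/-! ### Search paths follow links -/

/-- The relation is cut down to links between father and child, which is symmetric, so that the walk
can be reversed for `descend`; `T.Link` itself is not symmetric. -/
theorem climb_isWalk {u : ℕ × ℕ} {r : ℕ} (hu : u ∈ T.nodes) (huH : u.1 ≤ T.height)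
    (hr : r ≤ u.1) :
    IsWalk (fun x y => x ∈ T.nodes ∧ y ∈ T.nodes ∧
      ((x.1 < T.height ∧ y.1 = x.1 + 1 ∧ y.2 / 2 = x.2) ∨
        (y.1 < T.height ∧ x.1 = y.1 + 1 ∧ x.2 / 2 = y.2)))
      u (r, u.2 / 2 ^ (u.1 - r)) (climb u r) := by
  have hmem : ∀ j ≤ u.1, (u.1 - j, u.2 / 2 ^ j) ∈ T.nodes := fun j hj => by
    have h2 := (T.mem_nodes.1 hu).2
    rw [T.width_of_le huH] at h2
    rw [T.mem_nodes_of_le (by omega)]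
    have := div_two_pow_lt (r := u.1 - j) (by omega) h2
    rwa [Nat.sub_sub_self hj] at this
  have h := IsWalk.map_range (R := fun x y => x ∈ T.nodes ∧ y ∈ T.nodes ∧
      ((x.1 < T.height ∧ y.1 = x.1 + 1 ∧ y.2 / 2 = x.2) ∨
        (y.1 < T.height ∧ x.1 = y.1 + 1 ∧ x.2 / 2 = y.2)))
    (fun j => (u.1 - j, u.2 / 2 ^ j)) (u.1 - r) fun j hj => by
      refine ⟨hmem j (by omega), hmem (j + 1) (by omega), Or.inr ⟨?_, ?_, ?_⟩⟩
      · simp only; omega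
      · simp only; omega
      · simp only [pow_succ, Nat.div_div_eq_div_mul]
  simpa [climb, Nat.sub_sub_self hr] using h

theorem link_of_treeLink {k : Routing} {x y : ℕ × ℕ} (h : x ∈ T.nodes ∧ y ∈ T.nodes ∧
      ((x.1 < T.height ∧ y.1 = x.1 + 1 ∧ y.2 / 2 = x.2) ∨
        (y.1 < T.height ∧ x.1 = y.1 + 1 ∧ x.2 / 2 = y.2))) : T.Link k x y :=
  ⟨h.1, h.2.1, Or.inl (by unfold VerticalLink; tauto)⟩

theorem representative_mem {c : ℕ} (hc : c < T.offset (2 ^ T.height)) :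
    (T.height, T.bucketOf c) ∈ T.nodes :=
  (T.mem_nodes_of_le le_rfl).2 (T.bucketOf_spec hc).1

theorem ascend_isWalk (k : Routing) {u : ℕ × ℕ} {r : ℕ} (hu : u ∈ T.nodes) (hr : r ≤ T.height)
    (hru : r ≤ u.1) : IsWalk (T.Link k) u (r, T.ancestor u r) (T.ascend u r) := by
  unfold ascend
  split_ifs with h
  · rw [T.ancestor_of_le h]
    exact (T.climb_isWalk hu h hru).imp fun x y => T.link_of_treeLink
  · have h' : u.1 = T.height + 1 := by have := T.row_cases hu; omega
    have h2 := (T.mem_nodes.1 hu).2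
    rw [h', T.width_bucket] at h2
    rw [T.ancestor_bucket h' hr]
    have hm := T.representative_mem h2
    refine IsWalk.cons ⟨hu, hm, Or.inl ?_⟩
      ((T.climb_isWalk hm le_rfl hr).imp fun x y => T.link_of_treeLink)
    iterate 5 right
    exact Or.inl ⟨h', rfl⟩

theorem descend_isWalk (k : Routing) {z : ℕ × ℕ} {r : ℕ} (hz : z ∈ T.nodes) (hr : r ≤ T.height)
    (hrz : r ≤ z.1) : IsWalk (T.Link k) (r, T.ancestor z r) z (T.descend r z) := by
  have down : ∀ u ∈ T.nodes, u.1 ≤ T.height → r ≤ u.1 →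
      IsWalk (T.Link k) (r, u.2 / 2 ^ (u.1 - r)) u (climb u r).reverse := fun u h1 h2 h3 =>
    ((T.climb_isWalk h1 h2 h3).reverse fun x y h => ⟨h.2.1, h.1, h.2.2.symm⟩).imp
      fun x y => T.link_of_treeLink
  unfold descend
  split_ifs with h
  · rw [T.ancestor_of_le h]
    exact down z hz h hrz
  · have h' : z.1 = T.height + 1 := by have := T.row_cases hz; omega
    have h2 := (T.mem_nodes.1 hz).2
    rw [h', T.width_bucket] at h2
    rw [T.ancestor_bucket h' hr]
    obtain ⟨hb, hb1, hb2⟩ := T.bucketOf_spec h2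
    have hm := T.representative_mem h2
    have hmem : ∀ j ≤ z.2 - T.offset (T.bucketOf z.2),
        (T.height + 1, T.offset (T.bucketOf z.2) + j) ∈ T.nodes ∧
        T.bucketOf (T.offset (T.bucketOf z.2) + j) = T.bucketOf z.2 := fun j hj =>
      ⟨T.mem_nodes_bucket.2 (by omega), T.bucketOf_eq hb (by omega) (by omega)⟩
    have hw := IsWalk.map_range (R := T.Link k)
      (fun j => (T.height + 1, T.offset (T.bucketOf z.2) + j))
      (z.2 - T.offset (T.bucketOf z.2)) fun j hj => by
        refine ⟨(hmem j hj.le).1, (hmem (j + 1) hj).1, Or.inl ?_⟩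
        iterate 6 right
        refine ⟨rfl, rfl, ?_, Or.inl rfl⟩
        simp only
        rw [(hmem j hj.le).2, (hmem (j + 1) hj).2]
    have hz' : (T.height + 1, T.offset (T.bucketOf z.2) + (z.2 - T.offset (T.bucketOf z.2))) = z :=
      Prod.ext h'.symm (by simp only; omega)
    rw [hz'] at hw
    refine (down _ hm le_rfl hr).append hw ⟨hm, (hmem 0 (by omega)).1, Or.inl ?_⟩
    iterate 4 right
    exact Or.inl ⟨rfl, rfl⟩

theorem leftLeaf_mem {u : ℕ × ℕ} (hu : u ∈ T.nodes) (huH : u.1 < T.height) :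
    T.leftLeaf u ∈ T.nodes := by
  have h := T.middle_lt hu le_rfl huH
  rw [middle, if_pos le_rfl] at h
  exact (T.mem_nodes_of_le le_rfl).2 ((Nat.sub_le _ _).trans_lt h)

theorem rightLeaf_mem {u : ℕ × ℕ} (hu : u ∈ T.nodes) (huH : u.1 < T.height) :
    T.rightLeaf u ∈ T.nodes := by
  have h := T.middle_lt hu le_rfl huH
  rw [middle, if_pos le_rfl] at h
  exact (T.mem_nodes_of_le le_rfl).2 h

theorem vertical_isWalk (k : Routing) {v z : ℕ × ℕ} (hv : v ∈ T.nodes) (hz : z ∈ T.nodes) :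
    IsWalk (T.Link k) (T.haltNode v z) z (T.vertical v z) := by
  have hu := T.haltNode_mem hv hz
  have hvr := T.row_cases hv
  have hzr := T.row_cases hz
  unfold vertical verticalFrom
  by_cases h1 : T.haltNode v z = z
  · rw [if_pos h1]
    have := IsWalk.singleton (R := T.Link k) (T.haltNode v z)
    rwa [h1] at this ⊢
  -- A target in the row of the source is its own halting node, so a nontrivial vertical phase
  -- changes rows.
  have hne : v.1 ≠ z.1 := fun h => h1 <| Prod.ext h <| by
    change T.haltPos v z = z.2
    rw [T.haltPos_of_le h.le, h, T.ancestor_self]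
  have hlast : IsWalk (T.Link k) (T.haltNode v z) z (if (T.haltNode v z).1 < z.1 then
      T.descend (T.haltNode v z).1 z else T.ascend (T.haltNode v z) z.1) := by
    have e : (T.haltNode v z).1 = v.1 := rfl
    split_ifs with h3
    · have := T.descend_isWalk k (r := v.1) hz (by omega) (by omega)
      rwa [← T.haltPos_of_le (by omega)] at this
    · have := T.ascend_isWalk k (r := z.1) hu (by omega) (by omega)
      rwa [T.ancestor_haltNode_target hv hz (by omega)] at this
  rw [if_neg h1]
  by_cases h2 : (T.haltNode v z).1 < T.height
  · rw [if_pos h2]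
    have hl := T.leftLeaf_mem hu h2
    have hr := T.rightLeaf_mem hu h2
    refine IsWalk.append (b := T.rightLeaf (T.haltNode v z)) ?_ hlast
      ⟨hr, hu, Or.inl (Or.inr (Or.inr (Or.inr (Or.inl ⟨h2, Or.inr rfl⟩))))⟩
    refine IsWalk.cons (b := T.leftLeaf (T.haltNode v z))
      ⟨hu, hl, Or.inl (Or.inr (Or.inr (Or.inl ⟨h2, Or.inl rfl⟩)))⟩ ?_
    refine IsWalk.cons (b := T.haltNode v z)
      ⟨hl, hu, Or.inl (Or.inr (Or.inr (Or.inr (Or.inl ⟨h2, Or.inl rfl⟩))))⟩ ?_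
    exact IsWalk.cons (b := T.rightLeaf (T.haltNode v z))
      ⟨hu, hr, Or.inl (Or.inr (Or.inr (Or.inl ⟨h2, Or.inr rfl⟩)))⟩ (IsWalk.singleton _)
  · rw [if_neg h2, List.nil_append]
    exact hlast

theorem horizontal_isWalk (k : Routing) {v z : ℕ × ℕ} (hv : v ∈ T.nodes) (hz : z ∈ T.nodes) :
    IsWalk (T.Link k) v (T.haltNode v z) (T.horizontal k v z) := by
  obtain ⟨h1, h2⟩ := T.mem_nodes.1 hv
  have hw : IsWalk (fun c d => c < T.width v.1 ∧ d < T.width v.1 ∧ Row.Link k (T.width v.1) c d)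
      v.2 (T.haltPos v z) (Row.route k (T.width v.1) v.2 (T.haltPos v z)) := by
    cases k with
    | table => exact Row.route_table_isWalk h2 (T.haltPos_lt hv hz)
    | hyper => exact Row.route_hyper_isWalk h2 (T.haltPos_lt hv hz)
  exact hw.map (Prod.mk v.1) fun c d h =>
    ⟨T.mem_nodes.2 ⟨h1, h.1⟩, T.mem_nodes.2 ⟨h1, h.2.1⟩, Or.inr ⟨rfl, h.2.2⟩⟩

theorem search_isPath (k : Routing) {v z : ℕ × ℕ} (hv : v ∈ T.nodes) (hz : z ∈ T.nodes) :
    T.IsPath k v z (T.search k v z) :=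
  (T.horizontal_isWalk k hv hz).glue (T.vertical_isWalk k hv hz)

end D2Tree

namespace D2Tree

variable (T : D2Tree)

/-! ### Expected visits as a count of pairs -/

/-- The number of pairs of a source and a target for which `path` visits `x`. -/
def visitCount (path : ℕ × ℕ → ℕ × ℕ → List (ℕ × ℕ)) (x : ℕ × ℕ) : ℕ :=
  ((T.nodes ×ˢ T.nodes).filter fun vz => x ∈ path vz.1 vz.2).card

/-- One coordinate of a uniformly random function is uniform: split it off and average over the
others. -/
theorem _root_.Fintype.expect_apply {ι β : Type*} [Fintype ι] [DecidableEq ι] [Fintype β]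
    [Nonempty β] (i : ι) (f : β → ℝ) : 𝔼 t : ι → β, f (t i) = 𝔼 y, f y := by
  rw [Fintype.expect_equiv (Equiv.funSplitAt i β) (fun t => f (t i)) (fun y => f y.1)
    (fun t => rfl)]
  rw [← Finset.univ_product_univ, Finset.expect_product]
  refine Finset.expect_congr rfl fun y _ => ?_
  have hne : (Finset.univ : Finset ({j // j ≠ i} → β)).Nonempty := Finset.univ_nonempty
  exact Finset.expect_const hne (f y)

/-- Linearity of expectation over the sources; only the uniform distribution of each single target
matters. -/
theorem expectedVisits_eq (path : ℕ × ℕ → ℕ × ℕ → List (ℕ × ℕ)) (x : ℕ × ℕ) :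
    T.expectedVisits path x = T.visitCount path x / T.N := by
  rcases T.nodes.eq_empty_or_nonempty with h0 | h0
  · have : IsEmpty T.nodes := by rw [h0]; infer_instance
    simp [expectedVisits, visitCount, h0]
  have : Nonempty T.nodes := h0.to_subtype
  unfold expectedVisits
  have h1 : ∀ t : T.nodes → T.nodes,
      ((Finset.univ.filter fun v : T.nodes => x ∈ path v (t v)).card : ℝ) =
        ∑ v : T.nodes, if x ∈ path v (t v) then 1 else 0 := fun t => by
    rw [Finset.card_filter]
    push_cast
    rfl
  rw [Finset.expect_congr rfl fun t _ => h1 t, Finset.expect_sum_comm]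
  have h2 : ∀ v : T.nodes, (𝔼 t : T.nodes → T.nodes, if x ∈ path v (t v) then (1 : ℝ) else 0) =
      (∑ z : T.nodes, if x ∈ path v z then (1 : ℝ) else 0) / T.N := fun v => by
    rw [Fintype.expect_apply v (fun z : T.nodes => if x ∈ path v z then (1 : ℝ) else 0),
      Fintype.expect_eq_sum_div_card, Fintype.card_coe, N]
  rw [Finset.sum_congr rfl fun v _ => h2 v, ← Finset.sum_div]
  congr 1
  rw [visitCount, Finset.card_filter, Finset.sum_product]
  push_cast
  rw [← Finset.sum_coe_sort T.nodes]
  refine Finset.sum_congr rfl fun v _ => ?_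
  rw [← Finset.sum_coe_sort T.nodes]

theorem visitCount_search_le (k : Routing) (x : ℕ × ℕ) :
    T.visitCount (T.search k) x ≤ T.visitCount (T.horizontal k) x + T.visitCount T.vertical x := by
  unfold visitCount
  refine (Finset.card_le_card fun vz h => ?_).trans (Finset.card_union_le _ _)
  rw [Finset.mem_union, Finset.mem_filter, Finset.mem_filter]
  rw [Finset.mem_filter, search, List.mem_append] at h
  exact h.2.imp (fun h' => ⟨h.1, h'⟩) fun h' => ⟨h.1, List.mem_of_mem_tail h'⟩

/-! ### Numbers of nodes -/

theorem sum_two_pow (n : ℕ) : ∑ r ∈ Finset.range n, 2 ^ r + 1 = 2 ^ n := by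
  induction n with
  | zero => simp
  | succ n ih => rw [Finset.sum_range_succ, pow_succ]; omega

theorem N_add_one : T.N + 1 = 2 ^ (T.height + 1) + T.offset (2 ^ T.height) := by
  have h : T.N = ∑ r ∈ Finset.range (T.height + 2), T.width r := by
    rw [N, nodes, Finset.card_biUnion]
    · refine Finset.sum_congr rfl fun r _ => ?_
      rw [Finset.card_image_of_injective _ (Prod.mk_right_injective r), Finset.card_range]
    · intro r _ r' _ hne
      rw [Function.onFun, Finset.disjoint_left]
      rintro x hx hx'
      obtain ⟨c, -, rfl⟩ := Finset.mem_image.1 hx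
      obtain ⟨c', -, hc'⟩ := Finset.mem_image.1 hx'
      exact hne (Prod.ext_iff.1 hc').1.symm
  have h2 := sum_two_pow (T.height + 1)
  rw [h, Finset.sum_range_succ, T.width_bucket,
    Finset.sum_congr rfl fun r hr => T.width_of_le (by rw [Finset.mem_range] at hr; omega)]
  omega

theorem two_pow_le_width_bucket : 2 ^ T.height ≤ T.offset (2 ^ T.height) := T.le_offset le_rfl

theorem two_pow_le_N : 2 ^ (T.height + 1) ≤ T.N := by
  have := T.N_add_one
  have := T.two_pow_le_width_bucket
  have := Nat.one_le_two_pow (n := T.height)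
  omega

theorem width_bucket_le_N : T.offset (2 ^ T.height) ≤ T.N := by
  have := T.N_add_one
  have := Nat.one_le_two_pow (n := T.height + 1)
  omega

theorem two_le_N : 2 ≤ T.N := by
  have h := T.two_pow_le_N
  rw [pow_succ] at h
  have := Nat.one_le_two_pow (n := T.height)
  omega

theorem width_le_N {r : ℕ} (hr : r < T.height + 2) : T.width r ≤ T.N := by
  rcases Nat.lt_or_ge T.height r with h | h
  · rw [show r = T.height + 1 by omega, T.width_bucket]
    exact T.width_bucket_le_N
  · rw [T.width_of_le h]
    exact (Nat.pow_le_pow_right (by norm_num) (by omega)).trans T.two_pow_le_N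

theorem width_pos {r : ℕ} : 0 < T.width r := by
  unfold width
  split_ifs
  · positivity
  · exact lt_of_lt_of_le (by positivity) T.two_pow_le_width_bucket

theorem card_rows_le {ρ : ℕ} (hρ : ρ ≤ T.height) :
    (T.nodes.filter fun v => v.1 ≤ ρ).card ≤ 2 ^ (ρ + 1) := by
  have hsub : (T.nodes.filter fun v => v.1 ≤ ρ) ⊆
      (Finset.range (ρ + 1)).biUnion fun r => (Finset.range (2 ^ r)).image (Prod.mk r) := by
    intro v hv
    rw [Finset.mem_filter, mem_nodes] at hv
    obtain ⟨⟨-, h1⟩, h2⟩ := hv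
    rw [T.width_of_le (by omega)] at h1
    exact Finset.mem_biUnion.2 ⟨v.1, Finset.mem_range.2 (by omega),
      Finset.mem_image.2 ⟨v.2, Finset.mem_range.2 h1, rfl⟩⟩
  refine (Finset.card_le_card hsub).trans (Finset.card_biUnion_le.trans ?_)
  rw [← sum_two_pow]
  refine (Finset.sum_le_sum fun r _ => ?_).trans (Nat.le_succ _)
  exact Finset.card_image_le.trans (Finset.card_range _).le

section balanced

variable {T} {a b : ℝ}

/-- The only place where the lower bound on the average bucket size enters: it makes b log N at most
a constant multiple of N/2^H. -/
theorem Balanced.two_pow_mul_log_le (h : T.Balanced a b) (ha : 0 < a) :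
    2 ^ T.height * Real.log T.N ≤ T.N / a := by
  rw [le_div_iff₀ ha]
  have h1 : (T.offset (2 ^ T.height) : ℝ) ≤ T.N := by exact_mod_cast T.width_bucket_le_N
  have h2 := h.2
  calc _ = a * Real.log T.N * 2 ^ T.height := by ring
    _ ≤ _ := h2.trans h1

theorem Balanced.offset_add_le (h : T.Balanced a b) {i n : ℕ} (hin : i + n ≤ 2 ^ T.height) :
    (T.offset (i + n) : ℝ) ≤ T.offset i + n * (b * Real.log T.N) := by
  induction n with
  | zero => simp
  | succ n ih =>
    have h1 := ih (by omega)
    have h2 := h.1 (i + n) (by omega)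
    rw [← add_assoc, T.offset_succ]
    push_cast
    linarith

end balanced

/-! ### Subtrees and targets with a given halting position -/

/-- The node in row `r` at position `q`, its descendants and their buckets. -/
def subtree (r q : ℕ) : Finset (ℕ × ℕ) := T.nodes.filter fun z => r ≤ z.1 ∧ T.ancestor z r = q

theorem mem_Ico_of_div_eq {c q n : ℕ} (hn : 0 < n) (h : c / n = q) :
    q * n ≤ c ∧ c < (q + 1) * n := by
  subst h
  exact ⟨Nat.div_mul_le_self c n, by rw [Nat.mul_comm]; exact Nat.lt_mul_div_succ c hn⟩

/-- With d = H - r, the subtree has fewer than 2^(d+1) tree nodes and 2^d buckets of at most b log N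
nodes. After multiplication by 2^r the former contribute at most N and the latter at most (b/a)N. -/
theorem Balanced.card_subtree_mul_le {T : D2Tree} {a b : ℝ} (h : T.Balanced a b) (ha : 0 < a)
    (hb : 0 < b) {r q : ℕ} (hr : r ≤ T.height) (hq : q < 2 ^ r) :
    ((T.subtree r q).card : ℝ) * 2 ^ r ≤ (1 + b / a) * T.N := by
  obtain ⟨d, hd⟩ := Nat.exists_eq_add_of_le hr
  let A : Finset (ℕ × ℕ) := (Finset.range (d + 1)).biUnion fun j =>
    (Finset.Ico (q * 2 ^ j) ((q + 1) * 2 ^ j)).image (Prod.mk (r + j))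
  let B : Finset (ℕ × ℕ) := (Finset.Ico (T.offset (q * 2 ^ d))
    (T.offset ((q + 1) * 2 ^ d))).image (Prod.mk (T.height + 1))
  have hsub : T.subtree r q ⊆ A ∪ B := by
    intro z hz
    rw [subtree, Finset.mem_filter] at hz
    obtain ⟨hz, h1, h2⟩ := hz
    rw [Finset.mem_union]
    rcases T.row_cases hz with hz1 | hz1
    · left
      rw [T.ancestor_of_le hz1] at h2
      refine Finset.mem_biUnion.2 ⟨z.1 - r, Finset.mem_range.2 (by omega), Finset.mem_image.2
        ⟨z.2, Finset.mem_Ico.2 (mem_Ico_of_div_eq (by positivity) h2), ?_⟩⟩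
      rw [Nat.add_sub_cancel' h1]
    · right
      rw [T.ancestor_bucket hz1 hr, show T.height - r = d by omega] at h2
      obtain ⟨h3, h4⟩ := mem_Ico_of_div_eq (by positivity) h2
      have h5 := (T.mem_nodes.1 hz).2
      rw [hz1, T.width_bucket] at h5
      obtain ⟨-, h6, h7⟩ := T.bucketOf_spec h5
      refine Finset.mem_image.2 ⟨z.2, Finset.mem_Ico.2 ⟨(T.offset_mono h3).trans h6,
        h7.trans_le (T.offset_mono h4)⟩, ?_⟩
      rw [← hz1]
  have hA : A.card ≤ 2 ^ (d + 1) := by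
    refine Finset.card_biUnion_le.trans ?_
    rw [← sum_two_pow]
    refine (Finset.sum_le_sum fun j _ => ?_).trans (Nat.le_succ _)
    refine Finset.card_image_le.trans ?_
    rw [Nat.card_Ico, Nat.add_one_mul, Nat.add_sub_cancel_left]
  have hB : (B.card : ℝ) ≤ 2 ^ d * (b * Real.log T.N) := by
    have h1 : B.card ≤ T.offset ((q + 1) * 2 ^ d) - T.offset (q * 2 ^ d) :=
      Finset.card_image_le.trans (Nat.card_Ico _ _).le
    have h2 : (q + 1) * 2 ^ d ≤ 2 ^ T.height := by
      rw [hd, pow_add]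
      exact Nat.mul_le_mul_right _ hq
    have h3 := T.offset_mono (show q * 2 ^ d ≤ (q + 1) * 2 ^ d by
      exact Nat.mul_le_mul_right _ (by omega))
    rw [Nat.add_one_mul] at h1 h2 h3
    have h4 := h.offset_add_le h2
    have h5 : (B.card : ℝ) ≤ T.offset (q * 2 ^ d + 2 ^ d) - T.offset (q * 2 ^ d) := by
      rw [← Nat.cast_sub h3]
      exact_mod_cast h1
    push_cast at h4
    linarith
  have hcard : ((T.subtree r q).card : ℝ) ≤ A.card + B.card := by
    exact_mod_cast (Finset.card_le_card hsub).trans (Finset.card_union_le A B)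
  have hA' : (A.card : ℝ) ≤ 2 ^ (d + 1) := by exact_mod_cast hA
  have hN : (2 : ℝ) ^ (T.height + 1) ≤ T.N := by exact_mod_cast T.two_pow_le_N
  have hlog := h.two_pow_mul_log_le ha
  calc ((T.subtree r q).card : ℝ) * 2 ^ r
      ≤ (2 ^ (d + 1) + 2 ^ d * (b * Real.log T.N)) * 2 ^ r := by gcongr; linarith
    _ = 2 ^ (T.height + 1) + b * (2 ^ T.height * Real.log T.N) := by rw [hd]; ring
    _ ≤ T.N + b * (T.N / a) := by gcongr
    _ = _ := by ring

/-- The internal nodes `z` above row `r` whose right subtree begins at position `m` of row `r`. -/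
def middleNodes (r m : ℕ) : Finset (ℕ × ℕ) :=
  T.nodes.filter fun z => z.1 < r ∧ z.1 < T.height ∧ T.middle z r = m

theorem card_middleNodes_le {r : ℕ} (hr : r < T.height + 2) (m : ℕ) :
    (T.middleNodes r m).card ≤ 1 := by
  refine Finset.card_le_one.2 fun z hz z' hz' => ?_
  rw [middleNodes, Finset.mem_filter] at hz hz'
  obtain ⟨hz, h1, h2, h3⟩ := hz
  obtain ⟨hz', h1', h2', h3'⟩ := hz'
  rcases Nat.lt_or_ge T.height r with h | h
  · obtain rfl : r = T.height + 1 := by omega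
    rw [middle_bucket] at h3 h3'
    exact T.middle_inj le_rfl h2 h2' (T.offset_inj (T.middle_lt hz le_rfl h2).le
      (T.middle_lt hz' le_rfl h2').le (h3.trans h3'.symm))
  · exact T.middle_inj h h1 h1' (h3.trans h3'.symm)

open Classical in
/-- The targets for which some search issued in row `r` may halt at position `q`. -/
noncomputable def haltTargets (r q : ℕ) : Finset (ℕ × ℕ) :=
  T.nodes.filter fun z => ∃ v ∈ T.nodes, v.1 = r ∧ T.haltPos v z = q

/-- Beyond the targets at or below the row, an internal target above it has q just before or just
after its boundary, and a representative sends bucket sources to the first node of its bucket. -/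
theorem haltTargets_subset {r q : ℕ} : T.haltTargets r q ⊆
    T.subtree r q ∪ T.middleNodes r (q + 1) ∪ T.middleNodes r q ∪
      T.nodes.filter fun z => r = T.height + 1 ∧ z.1 = T.height ∧ T.offset z.2 = q := by
  classical
  intro z hz
  rw [haltTargets, Finset.mem_filter] at hz
  obtain ⟨hz, v, hv, rfl, hq⟩ := hz
  simp only [Finset.mem_union, subtree, middleNodes, Finset.mem_filter]
  rcases le_or_gt v.1 z.1 with h | h
  · rw [T.haltPos_of_le h] at hq
    exact Or.inl (Or.inl (Or.inl ⟨hz, h, hq⟩))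
  have hv1 := T.row_cases hv
  rcases lt_or_ge z.1 T.height with hz1 | hz1
  · have hpos : 0 < T.middle z v.1 := by
      rcases hv1 with hv1 | hv1
      · exact T.middle_pos hv1 h
      · rw [hv1, middle_bucket]
        exact (T.middle_pos le_rfl hz1).trans_le (T.le_offset (T.middle_lt hz le_rfl hz1).le)
    rcases T.haltPos_internal h hz1 with h' | h'
    · exact Or.inl (Or.inl (Or.inr ⟨hz, h, hz1, by omega⟩))
    · exact Or.inl (Or.inr ⟨hz, h, hz1, by omega⟩)
  · have hz2 : z.1 = T.height := by omega
    rw [T.haltPos_leaf h hz2] at hq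
    exact Or.inr ⟨hz, by omega, hz2, hq⟩

/-- In a tree row, a subtree and two internal targets give 3 + b/a; in the bucket row there are at
most four targets, and the width is at most N. -/
theorem Balanced.card_haltTargets_mul_le {T : D2Tree} {a b : ℝ} (h : T.Balanced a b) (ha : 0 < a)
    (hb : 0 < b) {r q : ℕ} (hr : r < T.height + 2) (hq : q < T.width r) :
    ((T.haltTargets r q).card : ℝ) * T.width r ≤ (4 + b / a) * T.N := by
  have hba : 0 < b / a := div_pos hb ha
  set L := T.nodes.filter fun z => r = T.height + 1 ∧ z.1 = T.height ∧ T.offset z.2 = q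
  have hcard : (T.haltTargets r q).card ≤ (T.subtree r q).card + 1 + 1 + L.card := by
    refine (Finset.card_le_card T.haltTargets_subset).trans <|
      (Finset.card_union_le _ _).trans <| Nat.add_le_add_right ?_ _
    refine (Finset.card_union_le _ _).trans <| add_le_add ?_ (T.card_middleNodes_le hr q)
    exact (Finset.card_union_le _ _).trans <| Nat.add_le_add_left (T.card_middleNodes_le hr _) _
  have hw : (T.width r : ℝ) ≤ T.N := by exact_mod_cast T.width_le_N hr
  rcases Nat.lt_or_ge T.height r with hrH | hrH
  · have hL : L.card ≤ 1 := by
      refine Finset.card_le_one.2 fun z hz z' hz' => ?_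
      rw [Finset.mem_filter, mem_nodes] at hz hz'
      obtain ⟨⟨-, h1⟩, -, h2, h3⟩ := hz
      obtain ⟨⟨-, h1'⟩, -, h2', h3'⟩ := hz'
      rw [h2, T.width_of_le le_rfl] at h1
      rw [h2', T.width_of_le le_rfl] at h1'
      exact Prod.ext (h2.trans h2'.symm) (T.offset_inj h1.le h1'.le (h3.trans h3'.symm))
    have hS : (T.subtree r q).card ≤ 1 := by
      refine Finset.card_le_one.2 fun z hz z' hz' => ?_
      rw [subtree, Finset.mem_filter, mem_nodes] at hz hz'
      obtain ⟨⟨h1, -⟩, h2, h3⟩ := hz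
      obtain ⟨⟨h1', -⟩, h2', h3'⟩ := hz'
      have e : z.1 = r := by omega
      have e' : z'.1 = r := by omega
      rw [← e, ancestor_self] at h3
      rw [← e', ancestor_self] at h3'
      exact Prod.ext (e.trans e'.symm) (h3.trans h3'.symm)
    have hcard' : ((T.haltTargets r q).card : ℝ) ≤ 4 := by
      exact_mod_cast hcard.trans (by omega)
    have hN : (0 : ℝ) ≤ T.N := Nat.cast_nonneg _
    calc _ ≤ 4 * (T.N : ℝ) := mul_le_mul hcard' hw (Nat.cast_nonneg _) (by norm_num)
      _ ≤ _ := by nlinarith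
  · have hL : L.card = 0 := by
      rw [Finset.card_eq_zero]
      exact Finset.filter_eq_empty_iff.2 fun z _ hz => by omega
    have hcard' : ((T.haltTargets r q).card : ℝ) ≤ (T.subtree r q).card + 2 := by
      exact_mod_cast hcard.trans (by omega)
    rw [T.width_of_le hrH] at hq
    have hS := h.card_subtree_mul_le ha hb hrH hq
    rw [T.width_of_le hrH] at hw ⊢
    push_cast at hw ⊢
    calc _ ≤ (((T.subtree r q).card : ℝ) + 2) * 2 ^ r := by gcongr
      _ = ((T.subtree r q).card : ℝ) * 2 ^ r + 2 * 2 ^ r := by ring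
      _ ≤ (1 + b / a) * T.N + 2 * T.N := by gcongr
      _ ≤ _ := by
        have hN : (0 : ℝ) ≤ T.N := Nat.cast_nonneg _
        nlinarith

/-! ### The horizontal phase -/

/-- Each of the at most B·M routes through x is used by O(N/M) pairs of source and target, so the
width M cancels. -/
theorem Balanced.visitCount_horizontal_le {T : D2Tree} {a b : ℝ} (h : T.Balanced a b)
    (ha : 0 < a) (hb : 0 < b) (k : Routing) {x : ℕ × ℕ} (hx : x ∈ T.nodes) {B : ℕ}
    (hB : Row.routeCount k (T.width x.1) x.2 ≤ B * T.width x.1) :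
    (T.visitCount (T.horizontal k) x : ℝ) ≤ (4 + b / a) * B * T.N := by
  classical
  have hr := (T.mem_nodes.1 hx).1
  set M := T.width x.1
  have hM : (0 : ℝ) < M := by exact_mod_cast T.width_pos
  let I := (Finset.range M ×ˢ Finset.range M).filter fun pq => x.2 ∈ Row.route k M pq.1 pq.2
  have hsub : ((T.nodes ×ˢ T.nodes).filter fun vz => x ∈ T.horizontal k vz.1 vz.2) ⊆
      I.biUnion fun pq => (T.haltTargets x.1 pq.2).image fun z => ((x.1, pq.1), z) := by
    intro vz hvz
    obtain ⟨v, z⟩ := vz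
    rw [Finset.mem_filter, Finset.mem_product] at hvz
    obtain ⟨⟨hv, hz⟩, hmem⟩ := hvz
    simp only at hv hz hmem
    rw [horizontal, List.mem_map] at hmem
    obtain ⟨c, hc, rfl⟩ := hmem
    refine Finset.mem_biUnion.2 ⟨(v.2, T.haltPos v z), Finset.mem_filter.2 ⟨?_, hc⟩, ?_⟩
    · exact Finset.mem_product.2 ⟨Finset.mem_range.2 (T.mem_nodes.1 hv).2,
        Finset.mem_range.2 (T.haltPos_lt hv hz)⟩
    · exact Finset.mem_image.2 ⟨z, Finset.mem_filter.2 ⟨hz, v, hv, rfl, rfl⟩, rfl⟩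
  have hle : ∀ pq ∈ I, ((T.haltTargets x.1 pq.2).card : ℝ) ≤ (4 + b / a) * T.N / M := by
    intro pq hpq
    rw [le_div_iff₀ hM]
    have := (Finset.mem_product.1 (Finset.mem_filter.1 hpq).1).2
    exact h.card_haltTargets_mul_le ha hb hr (Finset.mem_range.1 this)
  have h1 : (T.visitCount (T.horizontal k) x : ℝ) ≤
      ∑ pq ∈ I, ((T.haltTargets x.1 pq.2).card : ℝ) := by
    have := (Finset.card_le_card hsub).trans (Finset.card_biUnion_le.trans
      (Finset.sum_le_sum fun pq _ => Finset.card_image_le))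
    exact_mod_cast this
  have h2 := Finset.sum_le_card_nsmul I _ _ hle
  have hI : (I.card : ℝ) ≤ B * M := by exact_mod_cast hB
  have hK : 0 ≤ (4 + b / a) * T.N / M := by positivity
  rw [nsmul_eq_mul] at h2
  calc _ ≤ (I.card : ℝ) * ((4 + b / a) * T.N / M) := h1.trans h2
    _ ≤ B * M * ((4 + b / a) * T.N / M) := by gcongr
    _ = _ := by field_simp

/-! ### The vertical phase -/

theorem mem_climb {u x : ℕ × ℕ} {r : ℕ} (hr : r ≤ u.1) (h : x ∈ climb u r) :
    r ≤ x.1 ∧ x.1 ≤ u.1 ∧ x.2 = u.2 / 2 ^ (u.1 - x.1) := by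
  rw [climb, List.mem_map] at h
  obtain ⟨j, hj, rfl⟩ := h
  rw [List.mem_range] at hj
  refine ⟨by simp only; omega, by simp only; omega, ?_⟩
  simp only
  rw [Nat.sub_sub_self (by omega)]

theorem mem_ascend {u x : ℕ × ℕ} {r : ℕ} (hu : u ∈ T.nodes) (hr : r ≤ T.height) (hru : r ≤ u.1)
    (h : x ∈ T.ascend u r) :
    x = u ∨ r ≤ x.1 ∧ x.1 ≤ T.height ∧ x.1 ≤ u.1 ∧ T.ancestor u x.1 = x.2 := by
  unfold ascend at h
  split_ifs at h with huH
  · obtain ⟨h1, h2, h3⟩ := mem_climb hru h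
    exact Or.inr ⟨h1, by omega, h2, by rw [T.ancestor_of_le huH, h3]⟩
  · rcases List.mem_cons.1 h with h | h
    · exact Or.inl h
    · obtain ⟨h1, h2, h3⟩ := mem_climb hr h
      simp only at h2 h3
      have hu1 := T.row_cases hu
      exact Or.inr ⟨h1, h2, by omega, by rw [T.ancestor_bucket (by omega) h2, h3]⟩

theorem mem_descend {x z : ℕ × ℕ} {r : ℕ} (hz : z ∈ T.nodes) (hr : r ≤ T.height) (hrz : r ≤ z.1)
    (h : x ∈ T.descend r z) :
    (r ≤ x.1 ∧ x.1 ≤ T.height ∧ x.1 ≤ z.1 ∧ T.ancestor z x.1 = x.2) ∨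
      (x.1 = T.height + 1 ∧ z.1 = T.height + 1 ∧ T.bucketOf z.2 = T.bucketOf x.2) := by
  unfold descend at h
  split_ifs at h with hzH
  · rw [List.mem_reverse] at h
    obtain ⟨h1, h2, h3⟩ := mem_climb hrz h
    exact Or.inl ⟨h1, by omega, h2, by rw [T.ancestor_of_le hzH, h3]⟩
  · have hz1 : z.1 = T.height + 1 := by have := T.row_cases hz; omega
    rcases List.mem_append.1 h with h | h
    · rw [List.mem_reverse] at h
      obtain ⟨h1, h2, h3⟩ := mem_climb hr h
      simp only at h2 h3
      exact Or.inl ⟨h1, h2, by omega, by rw [T.ancestor_bucket hz1 h2, h3]⟩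
    · obtain ⟨j, hj, rfl⟩ := List.mem_map.1 h
      rw [List.mem_range] at hj
      have h5 := (T.mem_nodes.1 hz).2
      rw [hz1, T.width_bucket] at h5
      obtain ⟨h6, h7, h8⟩ := T.bucketOf_spec h5
      exact Or.inr ⟨rfl, hz1, (T.bucketOf_eq h6 (by simp only; omega) (by simp only; omega)).symm⟩

/-- The alternatives are chosen so that each admits only O(N) pairs. In the last one, an ascent
strictly below its target, x alone restricts z to two candidates. -/
theorem mem_vertical {v z x : ℕ × ℕ} (hv : v ∈ T.nodes) (hz : z ∈ T.nodes)
    (h : x ∈ T.vertical v z) :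
    z = x ∨ T.haltNode v z = x ∨
    (v.1 < T.height ∧ T.leftLeaf (T.haltNode v z) = x) ∨
    (v.1 < T.height ∧ T.rightLeaf (T.haltNode v z) = x) ∨
    (x.1 ≤ T.height ∧ v.1 ≤ x.1 ∧ z ∈ T.subtree x.1 x.2) ∨
    (x.1 = T.height + 1 ∧ v.1 ≤ T.height ∧ z.1 = T.height + 1 ∧
      T.bucketOf z.2 = T.bucketOf x.2) ∨
    (x.1 ≤ T.height ∧ z ∈ T.middleNodes x.1 (x.2 + 1) ∪ T.middleNodes x.1 x.2) := by
  have hu := T.haltNode_mem hv hz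
  have hvr := T.row_cases hv
  have hzr := T.row_cases hz
  have e : (T.haltNode v z).1 = v.1 := rfl
  unfold vertical verticalFrom at h
  by_cases h1 : T.haltNode v z = z
  · rw [if_pos h1, List.mem_singleton] at h
    exact Or.inr (Or.inl h.symm)
  have hne : v.1 ≠ z.1 := fun h => h1 <| Prod.ext h <| by
    change T.haltPos v z = z.2
    rw [T.haltPos_of_le h.le, h, T.ancestor_self]
  rw [if_neg h1, List.mem_append] at h
  rcases h with h | h
  · split_ifs at h with h2
    · simp only [List.mem_cons, List.not_mem_nil, or_false] at h
      rw [e] at h2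
      rcases h with h | h | h | h
      · exact Or.inr (Or.inl h.symm)
      · exact Or.inr (Or.inr (Or.inl ⟨h2, h.symm⟩))
      · exact Or.inr (Or.inl h.symm)
      · exact Or.inr (Or.inr (Or.inr (Or.inl ⟨h2, h.symm⟩)))
    · simp at h
  · split_ifs at h with h2
    · rcases T.mem_descend hz (by omega) (by omega) h with ⟨h3, h4, h5, h6⟩ | ⟨h3, h4, h5⟩
      · iterate 4 right
        exact Or.inl ⟨h4, h3, Finset.mem_filter.2 ⟨hz, h5, h6⟩⟩
      · iterate 5 right
        exact Or.inl ⟨h3, by omega, h4, h5⟩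
    · rcases T.mem_ascend hu (by omega) (by omega) h with h3 | ⟨h3, h4, h5, h6⟩
      · exact Or.inr (Or.inl h3.symm)
      rcases h3.eq_or_lt with h3 | h3
      · rw [← h3, T.ancestor_haltNode_target hv hz (by omega)] at h6
        exact Or.inl (Prod.ext h3 h6)
      · iterate 6 right
        refine ⟨h4, ?_⟩
        have hzH : z.1 < T.height := by omega
        have hpos := T.middle_pos h4 h3
        rw [Finset.mem_union, middleNodes, middleNodes, Finset.mem_filter, Finset.mem_filter]
        rcases T.ancestor_haltNode hv hz hzH h3 h4 h5 with h7 | h7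
        · exact Or.inl ⟨hz, h3, hzH, by omega⟩
        · exact Or.inr ⟨hz, h3, hzH, by omega⟩

/-- A search that halts at u was issued in the row of u, so the count is at most the width times the
number of halting targets. -/
theorem Balanced.card_haltPairs_le {T : D2Tree} {a b : ℝ} (h : T.Balanced a b) (ha : 0 < a)
    (hb : 0 < b) {u : ℕ × ℕ} (hu : u ∈ T.nodes) :
    (((T.nodes ×ˢ T.nodes).filter fun vz => T.haltNode vz.1 vz.2 = u).card : ℝ) ≤
      (4 + b / a) * T.N := by
  classical
  obtain ⟨hr, hc⟩ := T.mem_nodes.1 hu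
  have hsub : ((T.nodes ×ˢ T.nodes).filter fun vz => T.haltNode vz.1 vz.2 = u) ⊆
      ((Finset.range (T.width u.1)).image (Prod.mk u.1)) ×ˢ T.haltTargets u.1 u.2 := by
    intro vz hvz
    rw [Finset.mem_filter, Finset.mem_product] at hvz
    obtain ⟨⟨hv, hz⟩, rfl⟩ := hvz
    exact Finset.mem_product.2 ⟨Finset.mem_image.2 ⟨vz.1.2,
      Finset.mem_range.2 (T.mem_nodes.1 hv).2, rfl⟩, Finset.mem_filter.2 ⟨hz, vz.1, hv, rfl, rfl⟩⟩
  have h1 := Finset.card_le_card hsub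
  rw [Finset.card_product, Finset.card_image_of_injective _ (Prod.mk_right_injective u.1),
    Finset.card_range] at h1
  have h2 := h.card_haltTargets_mul_le ha hb hr hc
  rw [mul_comm] at h2
  refine le_trans ?_ h2
  exact_mod_cast h1

/-- By injectivity all these pairs share one halting node, so the bound for that node applies. -/
theorem Balanced.card_haltPairs_leaf_le {T : D2Tree} {a b : ℝ} (h : T.Balanced a b) (ha : 0 < a)
    (hb : 0 < b) (leaf : ℕ × ℕ → ℕ × ℕ) (hleaf : ∀ u u', u.1 < T.height → u'.1 < T.height →
      leaf u = leaf u' → u = u') (x : ℕ × ℕ) :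
    (((T.nodes ×ˢ T.nodes).filter fun vz =>
      vz.1.1 < T.height ∧ leaf (T.haltNode vz.1 vz.2) = x).card : ℝ) ≤ (4 + b / a) * T.N := by
  set S := (T.nodes ×ˢ T.nodes).filter fun vz =>
      vz.1.1 < T.height ∧ leaf (T.haltNode vz.1 vz.2) = x with hS
  rcases S.eq_empty_or_nonempty with h0 | ⟨⟨v, z⟩, hvz⟩
  · rw [h0, Finset.card_empty, Nat.cast_zero]
    positivity
  rw [hS, Finset.mem_filter, Finset.mem_product] at hvz
  obtain ⟨⟨hv, hz⟩, h1, h2⟩ := hvz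
  refine le_trans ?_ (h.card_haltPairs_le ha hb (T.haltNode_mem hv hz))
  refine Nat.cast_le.2 (Finset.card_le_card fun vz' h' => ?_)
  rw [hS, Finset.mem_filter] at h'
  exact Finset.mem_filter.2 ⟨h'.1, hleaf _ _ h'.2.1 h1 (h'.2.2.trans h2.symm)⟩

theorem rightLeaf_eq (u : ℕ × ℕ) : T.rightLeaf u = (T.height, T.middle u T.height) := by
  rw [rightLeaf, middle, if_pos le_rfl]

theorem leftLeaf_eq (u : ℕ × ℕ) : T.leftLeaf u = (T.height, T.middle u T.height - 1) := by
  rw [leftLeaf, middle, if_pos le_rfl]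

theorem rightLeaf_inj {u u' : ℕ × ℕ} (hu : u.1 < T.height) (hu' : u'.1 < T.height)
    (h : T.rightLeaf u = T.rightLeaf u') : u = u' := by
  rw [rightLeaf_eq, rightLeaf_eq, Prod.mk.injEq] at h
  exact T.middle_inj le_rfl hu hu' h.2

theorem leftLeaf_inj {u u' : ℕ × ℕ} (hu : u.1 < T.height) (hu' : u'.1 < T.height)
    (h : T.leftLeaf u = T.leftLeaf u') : u = u' := by
  rw [leftLeaf_eq, leftLeaf_eq, Prod.mk.injEq] at h
  have := T.middle_pos le_rfl hu
  have := T.middle_pos le_rfl hu'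
  exact T.middle_inj le_rfl hu hu' (by omega)

theorem Balanced.card_bucket_mul_le {T : D2Tree} {a b : ℝ} (h : T.Balanced a b) (ha : 0 < a)
    (hb : 0 < b) {i : ℕ} (hi : i < 2 ^ T.height) :
    ((T.nodes.filter fun z => z.1 = T.height + 1 ∧ T.bucketOf z.2 = i).card : ℝ) *
      2 ^ (T.height + 1) ≤ 2 * (b / a) * T.N := by
  have hsub : (T.nodes.filter fun z => z.1 = T.height + 1 ∧ T.bucketOf z.2 = i) ⊆
      (Finset.Ico (T.offset i) (T.offset (i + 1))).image (Prod.mk (T.height + 1)) := by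
    intro z hz
    rw [Finset.mem_filter, mem_nodes] at hz
    obtain ⟨⟨-, h5⟩, hz1, rfl⟩ := hz
    rw [hz1, T.width_bucket] at h5
    exact Finset.mem_image.2 ⟨z.2, Finset.mem_Ico.2 (T.bucketOf_spec h5).2, by rw [← hz1]⟩
  have h1 := (Finset.card_le_card hsub).trans Finset.card_image_le
  rw [Nat.card_Ico, T.offset_succ, Nat.add_sub_cancel_left] at h1
  have h2 : ((T.nodes.filter fun z => z.1 = T.height + 1 ∧ T.bucketOf z.2 = i).card : ℝ) ≤
      b * Real.log T.N := le_trans (by exact_mod_cast h1) (h.1 i hi)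
  have h3 := h.two_pow_mul_log_le ha
  calc _ ≤ b * Real.log T.N * 2 ^ (T.height + 1) := by gcongr
    _ = 2 * b * (2 ^ T.height * Real.log T.N) := by ring
    _ ≤ 2 * b * (T.N / a) := by gcongr
    _ = _ := by ring

/-- In units of N, with β = b/a, the seven classes contribute 1, three times 4 + β, 2(1 + β), 2β and
2. -/
theorem Balanced.visitCount_vertical_le {T : D2Tree} {a b : ℝ} (h : T.Balanced a b)
    (ha : 0 < a) (hb : 0 < b) {x : ℕ × ℕ} (hx : x ∈ T.nodes) :
    (T.visitCount T.vertical x : ℝ) ≤ (17 + 7 * (b / a)) * T.N := by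
  classical
  let P := T.nodes ×ˢ T.nodes
  let S₁ := T.nodes ×ˢ ({x} : Finset (ℕ × ℕ))
  let S₂ := P.filter fun vz => T.haltNode vz.1 vz.2 = x
  let S₃ := P.filter fun vz => vz.1.1 < T.height ∧ T.leftLeaf (T.haltNode vz.1 vz.2) = x
  let S₄ := P.filter fun vz => vz.1.1 < T.height ∧ T.rightLeaf (T.haltNode vz.1 vz.2) = x
  let S₅ := P.filter fun vz => x.1 ≤ T.height ∧ vz.1.1 ≤ x.1 ∧ vz.2 ∈ T.subtree x.1 x.2
  let S₆ := P.filter fun vz => x.1 = T.height + 1 ∧ vz.1.1 ≤ T.height ∧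
    vz.2.1 = T.height + 1 ∧ T.bucketOf vz.2.2 = T.bucketOf x.2
  let S₇ := T.nodes ×ˢ (T.middleNodes x.1 (x.2 + 1) ∪ T.middleNodes x.1 x.2)
  have hsub : (P.filter fun vz => x ∈ T.vertical vz.1 vz.2) ⊆
      S₁ ∪ (S₂ ∪ (S₃ ∪ (S₄ ∪ (S₅ ∪ (S₆ ∪ S₇))))) := by
    intro vz hvz
    rw [Finset.mem_filter] at hvz
    obtain ⟨hP, hmem⟩ := hvz
    obtain ⟨hv, hz⟩ := Finset.mem_product.1 hP
    simp only [Finset.mem_union, S₂, S₃, S₄, S₅, S₆, Finset.mem_filter]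
    rcases T.mem_vertical hv hz hmem with h' | h' | h' | h' | h' | h' | h'
    · exact Or.inl (Finset.mem_product.2 ⟨hv, Finset.mem_singleton.2 h'⟩)
    · exact Or.inr (Or.inl ⟨hP, h'⟩)
    · exact Or.inr (Or.inr (Or.inl ⟨hP, h'⟩))
    · exact Or.inr (Or.inr (Or.inr (Or.inl ⟨hP, h'⟩)))
    · exact Or.inr (Or.inr (Or.inr (Or.inr (Or.inl ⟨hP, h'⟩))))
    · exact Or.inr (Or.inr (Or.inr (Or.inr (Or.inr (Or.inl ⟨hP, h'⟩)))))
    · exact Or.inr (Or.inr (Or.inr (Or.inr (Or.inr (Or.inr (Finset.mem_product.2 ⟨hv, h'.2⟩))))))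
  have hN : (0 : ℝ) ≤ T.N := Nat.cast_nonneg _
  have hba : 0 < b / a := div_pos hb ha
  have c₁ : (S₁.card : ℝ) ≤ T.N := by
    rw [Finset.card_product, Finset.card_singleton, mul_one]
    exact le_rfl
  have c₂ : (S₂.card : ℝ) ≤ (4 + b / a) * T.N := h.card_haltPairs_le ha hb hx
  have c₃ : (S₃.card : ℝ) ≤ (4 + b / a) * T.N :=
    h.card_haltPairs_leaf_le ha hb T.leftLeaf (fun _ _ h1 h2 => T.leftLeaf_inj h1 h2) x
  have c₄ : (S₄.card : ℝ) ≤ (4 + b / a) * T.N :=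
    h.card_haltPairs_leaf_le ha hb T.rightLeaf (fun _ _ h1 h2 => T.rightLeaf_inj h1 h2) x
  have c₅ : (S₅.card : ℝ) ≤ 2 * (1 + b / a) * T.N := by
    rcases T.row_cases hx with hx1 | hx1
    · have hq := (T.mem_nodes.1 hx).2
      rw [T.width_of_le hx1] at hq
      have h1 : S₅ ⊆ (T.nodes.filter fun v => v.1 ≤ x.1) ×ˢ T.subtree x.1 x.2 := by
        intro vz hvz
        obtain ⟨hP, h1, h2, h3⟩ := Finset.mem_filter.1 hvz
        exact Finset.mem_product.2
          ⟨Finset.mem_filter.2 ⟨(Finset.mem_product.1 hP).1, h2⟩, h3⟩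
      have h2 := Finset.card_le_card h1
      rw [Finset.card_product] at h2
      have h3 := h2.trans (Nat.mul_le_mul_right _ (T.card_rows_le hx1))
      have h4 := h.card_subtree_mul_le ha hb hx1 hq
      calc (S₅.card : ℝ) ≤ 2 ^ (x.1 + 1) * (T.subtree x.1 x.2).card := by exact_mod_cast h3
        _ = 2 * ((T.subtree x.1 x.2).card * 2 ^ x.1) := by ring
        _ ≤ 2 * ((1 + b / a) * T.N) := by gcongr
        _ = _ := by ring
    · have h1 : S₅ = ∅ := Finset.filter_eq_empty_iff.2 fun z _ hz => by omega
      rw [h1, Finset.card_empty, Nat.cast_zero]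
      positivity
  have c₆ : (S₆.card : ℝ) ≤ 2 * (b / a) * T.N := by
    rcases T.row_cases hx with hx1 | hx1
    · have h1 : S₆ = ∅ := Finset.filter_eq_empty_iff.2 fun z _ hz => by omega
      rw [h1, Finset.card_empty, Nat.cast_zero]
      positivity
    · have hq := (T.mem_nodes.1 hx).2
      rw [hx1, T.width_bucket] at hq
      have h1 : S₆ ⊆ (T.nodes.filter fun v => v.1 ≤ T.height) ×ˢ
          (T.nodes.filter fun z => z.1 = T.height + 1 ∧ T.bucketOf z.2 = T.bucketOf x.2) := by
        intro vz hvz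
        obtain ⟨hP, -, h2, h3⟩ := Finset.mem_filter.1 hvz
        obtain ⟨hv, hz⟩ := Finset.mem_product.1 hP
        exact Finset.mem_product.2 ⟨Finset.mem_filter.2 ⟨hv, h2⟩, Finset.mem_filter.2 ⟨hz, h3⟩⟩
      have h2 := Finset.card_le_card h1
      rw [Finset.card_product] at h2
      have h3 := h2.trans (Nat.mul_le_mul_right _ (T.card_rows_le le_rfl))
      rw [mul_comm] at h3
      refine le_trans ?_ (h.card_bucket_mul_le ha hb (T.bucketOf_spec hq).1)
      exact_mod_cast h3
  have c₇ : (S₇.card : ℝ) ≤ 2 * T.N := by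
    have hr := (T.mem_nodes.1 hx).1
    have h1 : (T.middleNodes x.1 (x.2 + 1) ∪ T.middleNodes x.1 x.2).card ≤ 2 :=
      (Finset.card_union_le _ _).trans
        (add_le_add (T.card_middleNodes_le hr _) (T.card_middleNodes_le hr _))
    have h2 : S₇.card ≤ T.N * 2 := by
      rw [Finset.card_product]
      exact Nat.mul_le_mul_left _ h1
    rw [mul_comm]
    exact_mod_cast h2
  have hcard : T.visitCount T.vertical x ≤ S₁.card + (S₂.card + (S₃.card + (S₄.card + (S₅.card +
      (S₆.card + S₇.card))))) := by
    refine (Finset.card_le_card hsub).trans ?_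
    iterate 5 refine (Finset.card_union_le _ _).trans (Nat.add_le_add_left ?_ _)
    exact Finset.card_union_le _ _
  have hcard' : (T.visitCount T.vertical x : ℝ) ≤ S₁.card + (S₂.card + (S₃.card + (S₄.card +
      (S₅.card + (S₆.card + S₇.card))))) := by exact_mod_cast hcard
  refine hcard'.trans ?_
  calc _ ≤ (T.N : ℝ) + ((4 + b / a) * T.N + ((4 + b / a) * T.N + ((4 + b / a) * T.N +
        (2 * (1 + b / a) * T.N + (2 * (b / a) * T.N + 2 * T.N))))) := by gcongr
    _ = _ := by ring

end D2Tree

/-! ### Space -/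

theorem Row.link_table_mem {M c d : ℕ} (h : Row.Link .table M c d) :
    d ∈ (List.range (Nat.clog 2 M)).map (fun i => c + 2 ^ i) ++
      (List.range (Nat.clog 2 M)).map (fun i => c - 2 ^ i) := by
  obtain ⟨i, hi, h⟩ := h
  rw [List.mem_append, List.mem_map, List.mem_map]
  rcases h with h | h
  · exact Or.inl ⟨i, List.mem_range.2 hi, h.symm⟩
  · exact Or.inr ⟨i, List.mem_range.2 hi, by omega⟩

theorem Row.link_hyper_mem {M c d : ℕ} (h : Row.Link .hyper M c d) :
    d ∈ [c + 1, c - 1, Row.top M c, Row.rightEnd M c, Row.leftEnd M c] := by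
  simp only [List.mem_cons, List.not_mem_nil, or_false]
  rcases h with ⟨-, h | h⟩ | h | h | h
  · exact Or.inl h
  · exact Or.inr (Or.inl (by omega))
  · exact Or.inr (Or.inr (Or.inl h))
  · exact Or.inr (Or.inr (Or.inr (Or.inl h.2)))
  · exact Or.inr (Or.inr (Or.inr (Or.inr h.2)))

namespace D2Tree

variable (T : D2Tree)

/-- The only links not given by a formula lead from a leaf to internal nodes; by injectivity of
`leftLeaf` and `rightLeaf` there is at most one for each side. -/
theorem verticalLink_mem (x : ℕ × ℕ) :
    ∃ l : List (ℕ × ℕ), l.length = 11 ∧ ∀ y, T.VerticalLink x y → y ∈ l := by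
  have key : ∀ f : ℕ × ℕ → ℕ × ℕ, (∀ u u', u.1 < T.height → u'.1 < T.height → f u = f u' → u = u') →
      ∃ y₀, ∀ y, y.1 < T.height → x = f y → y = y₀ := by
    intro f hf
    by_cases h : ∃ y, y.1 < T.height ∧ x = f y
    · obtain ⟨y₀, h1, h2⟩ := h
      exact ⟨y₀, fun y h3 h4 => hf y y₀ h3 h1 (h4.symm.trans h2)⟩
    · exact ⟨(0, 0), fun y h3 h4 => absurd ⟨y, h3, h4⟩ h⟩
  obtain ⟨y₁, hy₁⟩ := key T.leftLeaf fun _ _ h1 h2 => T.leftLeaf_inj h1 h2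
  obtain ⟨y₂, hy₂⟩ := key T.rightLeaf fun _ _ h1 h2 => T.rightLeaf_inj h1 h2
  refine ⟨[(x.1 + 1, 2 * x.2), (x.1 + 1, 2 * x.2 + 1), (x.1 - 1, x.2 / 2), T.leftLeaf x,
    T.rightLeaf x, y₁, y₂, (T.height + 1, T.offset x.2), (T.height, T.bucketOf x.2),
    (T.height + 1, x.2 + 1), (T.height + 1, x.2 - 1)], rfl, fun y h => ?_⟩
  obtain ⟨r, c⟩ := y
  simp only [List.mem_cons, List.not_mem_nil, or_false]
  rcases h with ⟨h1, h2, h3⟩ | ⟨h1, h2, h3⟩ | ⟨-, h | h⟩ | ⟨h1, h | h⟩ | ⟨-, h⟩ | ⟨-, h⟩ |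
    ⟨-, h1, -, h2⟩
  · simp only at h2 h3
    rcases Nat.mod_two_eq_zero_or_one c with h4 | h4
    · exact Or.inl (Prod.ext h2 (by simp only; omega))
    · exact Or.inr (Or.inl (Prod.ext h2 (by simp only; omega)))
  · simp only at h2 h3
    exact Or.inr (Or.inr (Or.inl (Prod.ext (by simp only; omega) h3.symm)))
  · iterate 3 right
    exact Or.inl h
  · iterate 4 right
    exact Or.inl h
  · iterate 5 right
    exact Or.inl (hy₁ _ h1 h)
  · iterate 6 right
    exact Or.inl (hy₂ _ h1 h)
  · iterate 7 right
    exact Or.inl h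
  · iterate 8 right
    exact Or.inl h
  · simp only at h1 h2
    iterate 9 right
    rcases h2 with h2 | h2
    · exact Or.inl (Prod.ext h1 h2)
    · exact Or.inr (Prod.ext h1 (by simp only; omega))

theorem space_le {k : Routing} {x : ℕ × ℕ} {l : List ℕ}
    (hl : ∀ d, Row.Link k (T.width x.1) x.2 d → d ∈ l) : T.space k x ≤ 11 + l.length := by
  classical
  obtain ⟨l', h1, h2⟩ := T.verticalLink_mem x
  have hsub : {y | T.Link k x y} ⊆ ((l' ++ l.map (Prod.mk x.1)).toFinset : Set (ℕ × ℕ)) := by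
    rintro y ⟨-, -, h | ⟨h, h'⟩⟩
    · exact List.mem_toFinset.2 (List.mem_append_left _ (h2 y h))
    · refine List.mem_toFinset.2 (List.mem_append_right _ (List.mem_map.2 ⟨y.2, hl _ h', ?_⟩))
      exact Prod.ext h rfl
  refine (Set.ncard_le_ncard hsub (Finset.finite_toSet _)).trans ?_
  rw [Set.ncard_coe_finset]
  refine (List.toFinset_card_le _).trans ?_
  rw [List.length_append, List.length_map, h1]

theorem space_table_le (x : ℕ × ℕ) : T.space .table x ≤ 11 + 2 * Nat.clog 2 (T.width x.1) := by
  refine (T.space_le fun _ => Row.link_table_mem).trans ?_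
  rw [List.length_append, List.length_map, List.length_map, List.length_range]
  omega

theorem space_hyper_le (x : ℕ × ℕ) : T.space .hyper x ≤ 16 :=
  T.space_le fun _ => Row.link_hyper_mem

/-! ### Logarithms -/

theorem half_le_log_N : 1 / 2 ≤ Real.log T.N := by
  have h1 : (2 : ℝ) ≤ T.N := by exact_mod_cast T.two_le_N
  have h2 := Real.log_le_log (by norm_num) h1
  have := Real.log_two_gt_d9
  linarith

/-- With k the ceiling of log₂ N minus 1, k log 2 ≤ log N and log 2 > 1/2 give k ≤ 2 log N, and the
remaining 3 is at most 6 log N. -/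
theorem clog_width_le {r : ℕ} (hr : r < T.height + 2) :
    (Nat.clog 2 (T.width r) : ℝ) + 2 ≤ 8 * Real.log T.N := by
  have h1 : Nat.clog 2 (T.width r) ≤ Nat.clog 2 T.N := Nat.clog_mono_right 2 (T.width_le_N hr)
  have h2 := Nat.pow_pred_clog_lt_self (b := 2) (by norm_num) (x := T.N) T.two_le_N
  have h3 : (2 : ℝ) ^ (Nat.clog 2 T.N).pred ≤ T.N := by exact_mod_cast h2.le
  have h4 := Real.log_le_log (by positivity) h3
  rw [Real.log_pow] at h4
  have h5 : (Nat.clog 2 (T.width r) : ℝ) ≤ ((Nat.clog 2 T.N).pred : ℝ) + 1 := by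
    have : Nat.clog 2 (T.width r) ≤ (Nat.clog 2 T.N).pred + 1 := by
      rw [Nat.pred_eq_sub_one]
      omega
    exact_mod_cast this
  have h6 := T.half_le_log_N
  have h7 := Real.log_two_gt_d9
  have h8 : (0 : ℝ) ≤ ((Nat.clog 2 T.N).pred : ℝ) := Nat.cast_nonneg _
  nlinarith

/-- From N ≤ 2^H (2 + b log N), log N ≤ 2√N and 1 ≤ √N one gets √N ≤ 2^H (2 + 2b); take logarithms.
-/
theorem Balanced.log_N_le {T : D2Tree} {a b : ℝ} (h : T.Balanced a b) (hb : 0 < b) :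
    Real.log T.N ≤ (2 * Real.log (2 + 2 * b) + 2) * (T.height + 1) := by
  have hN : (2 : ℝ) ≤ T.N := by exact_mod_cast T.two_le_N
  have hsq : (0 : ℝ) < √T.N := Real.sqrt_pos.2 (by linarith)
  have hss : √(T.N : ℝ) * √T.N = T.N := Real.mul_self_sqrt (by linarith)
  have h1 : Real.log T.N ≤ 2 * √T.N := by
    have h2 := Real.log_le_sub_one_of_pos hsq
    rw [Real.log_sqrt (by linarith)] at h2
    linarith
  have h1' : 1 ≤ √(T.N : ℝ) := Real.one_le_sqrt.2 (by linarith)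
  have h2 := h.offset_add_le (i := 0) (n := 2 ^ T.height) (by omega)
  have h3 : (T.offset 0 : ℝ) = 0 := by simp [offset]
  rw [zero_add, h3, zero_add] at h2
  have h4 : (T.N : ℝ) + 1 = 2 ^ (T.height + 1) + T.offset (2 ^ T.height) := by
    exact_mod_cast T.N_add_one
  push_cast at h2
  have h5 : (T.N : ℝ) ≤ 2 ^ T.height * (2 + 2 * b) * √T.N := by
    calc (T.N : ℝ) ≤ 2 ^ T.height * (2 + b * Real.log T.N) := by
          rw [pow_succ] at h4
          linarith
      _ ≤ 2 ^ T.height * (2 * √T.N + b * (2 * √T.N)) := by gcongr; linarith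
      _ = _ := by ring
  have h6 : √(T.N : ℝ) ≤ 2 ^ T.height * (2 + 2 * b) := by
    refine le_of_mul_le_mul_right ?_ hsq
    rwa [hss]
  have h7 := Real.log_le_log hsq h6
  rw [Real.log_sqrt (by linarith), Real.log_mul (by positivity) (by positivity),
    Real.log_pow] at h7
  have h8 : 0 ≤ Real.log (2 + 2 * b) := Real.log_nonneg (by linarith)
  have h9 := Real.log_two_lt_d9
  have h10 : (0 : ℝ) ≤ T.height := Nat.cast_nonneg _
  nlinarith [mul_nonneg h8 h10]

/-! ### Congestion -/

section balanced

variable {T} {a b : ℝ}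

theorem Balanced.expectedVisits_horizontal_table_le (h : T.Balanced a b) (ha : 0 < a) (hb : 0 < b)
    {x : ℕ × ℕ} (hx : x ∈ T.nodes) :
    T.expectedVisits (T.horizontal .table) x ≤
      (4 + b / a) * (2 * (Nat.clog 2 (T.width x.1) + 1)) := by
  have hN : (0 : ℝ) < T.N := by exact_mod_cast (by have := T.two_le_N; omega : 0 < T.N)
  have h1 := h.visitCount_horizontal_le ha hb .table hx
    (B := 2 * (Nat.clog 2 (T.width x.1) + 1))
    ((Row.routeCount_table_le _ _).trans (le_of_eq (by ring)))
  rw [expectedVisits_eq, div_le_iff₀ hN]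
  push_cast at h1
  exact h1

theorem Balanced.expectedVisits_horizontal_hyper_le (h : T.Balanced a b) (ha : 0 < a) (hb : 0 < b)
    {x : ℕ × ℕ} (hx : x ∈ T.nodes) :
    T.expectedVisits (T.horizontal .hyper) x ≤
      (4 + b / a) * (26 * (Nat.clog 2 (T.width x.1) + 2)) := by
  have hN : (0 : ℝ) < T.N := by exact_mod_cast (by have := T.two_le_N; omega : 0 < T.N)
  have h1 := h.visitCount_horizontal_le ha hb .hyper hx
    (B := 26 * (Nat.clog 2 (T.width x.1) + 2))
    ((Row.routeCount_hyper_le _ _).trans (le_of_eq (by ring)))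
  rw [expectedVisits_eq, div_le_iff₀ hN]
  push_cast at h1
  exact h1

theorem Balanced.expectedVisits_vertical_le (h : T.Balanced a b) (ha : 0 < a) (hb : 0 < b)
    {x : ℕ × ℕ} (hx : x ∈ T.nodes) : T.expectedVisits T.vertical x ≤ 17 + 7 * (b / a) := by
  have hN : (0 : ℝ) < T.N := by exact_mod_cast (by have := T.two_le_N; omega : 0 < T.N)
  rw [expectedVisits_eq, div_le_iff₀ hN]
  exact h.visitCount_vertical_le ha hb hx

theorem expectedVisits_search_le (T : D2Tree) (k : Routing) (x : ℕ × ℕ) :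
    T.expectedVisits (T.search k) x ≤
      T.expectedVisits (T.horizontal k) x + T.expectedVisits T.vertical x := by
  rw [expectedVisits_eq, expectedVisits_eq, expectedVisits_eq, ← add_div]
  gcongr
  exact_mod_cast T.visitCount_search_le k x

/-- The factor 208 is 26 · 8, from the route count and `clog_width_le`; the vertical constant is
absorbed by 1 ≤ 2 log N. -/
theorem Balanced.congestion_le (h : T.Balanced a b) (ha : 0 < a) (hb : 0 < b) (k : Routing) :
    T.congestion k ≤ (208 * (4 + b / a) + 2 * (17 + 7 * (b / a))) * (Real.log T.N / T.N) := by
  have hba : 0 < b / a := div_pos hb ha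
  have hne : Nonempty T.nodes := by
    refine (Finset.card_pos.1 ?_).to_subtype
    have := T.two_le_N
    unfold N at this
    omega
  refine ciSup_le fun x => ?_
  rw [← mul_div_assoc]
  gcongr
  have hr := (T.mem_nodes.1 x.2).1
  have h1 := T.clog_width_le hr
  have h2 := T.half_le_log_N
  have h3 := h.expectedVisits_vertical_le ha hb x.2
  have hc : (0 : ℝ) ≤ Nat.clog 2 (T.width (x : ℕ × ℕ).1) := Nat.cast_nonneg _
  have h4 : T.expectedVisits (T.horizontal k) x ≤ (4 + b / a) * (208 * Real.log T.N) := by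
    cases k with
    | table =>
      refine (h.expectedVisits_horizontal_table_le ha hb x.2).trans (mul_le_mul_of_nonneg_left ?_ (by positivity))
      linarith
    | hyper =>
      refine (h.expectedVisits_horizontal_hyper_le ha hb x.2).trans (mul_le_mul_of_nonneg_left ?_ (by positivity))
      linarith
  refine (T.expectedVisits_search_le k x).trans ?_
  nlinarith

end balanced

end D2Tree

/-! ### Assembly of the theorem -/

theorem mainTheorem6 (a b : ℝ) (ha : 0 < a) (hb : 0 < b) :
    ∃ C : ℝ, ∀ T : D2Tree, T.Balanced a b →
      -- routing tables, `O(log N)` space per node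
      ((∀ x ∈ T.nodes, (T.space .table x : ℝ) ≤ C * Real.log T.N) ∧
        (∀ v ∈ T.nodes, ∀ z ∈ T.nodes, T.IsPath .table v z (T.search .table v z)) ∧
        (∀ x ∈ T.nodes, T.expectedVisits (T.horizontal .table) x ≤ C * (x.1 + 1)) ∧
        (∀ x ∈ T.nodes, T.expectedVisits T.vertical x ≤ C) ∧
        T.congestion .table ≤ C * (Real.log T.N / T.N)) ∧
      -- hypernodes, `O(1)` space per node
      ((∀ x ∈ T.nodes, (T.space .hyper x : ℝ) ≤ C) ∧
        (∀ v ∈ T.nodes, ∀ z ∈ T.nodes, T.IsPath .hyper v z (T.search .hyper v z)) ∧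
        T.congestion .hyper ≤ C * (Real.log T.N / T.N)) := by
  have hba : 0 < b / a := div_pos hb ha
  have hlb : 0 ≤ Real.log (2 + 2 * b) := Real.log_nonneg (by linarith)
  set K := 4 + b / a with hK
  set E := 2 * Real.log (2 + 2 * b) + 2 with hE
  have hKE : 0 ≤ K * E := by positivity
  -- The summands serve in turn the congestion (and the vertical phase), the space, and the
  -- horizontal table visits in tree rows and in the bucket row. The 38 is 22 + 16, as 11 ≤ 22 log N
  -- and 2 clog ≤ 16 log N.
  refine ⟨(208 * K + 2 * (17 + 7 * (b / a))) + 38 + 2 * K + 16 * (K * E), fun T h => ?_⟩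
  have hlog := T.half_le_log_N
  have hcong : ∀ k, T.congestion k ≤
      ((208 * K + 2 * (17 + 7 * (b / a))) + 38 + 2 * K + 16 * (K * E)) *
        (Real.log T.N / T.N) := fun k => by
    refine (h.congestion_le ha hb k).trans (mul_le_mul_of_nonneg_right ?_ (by positivity))
    rw [← hK]
    linarith
  refine ⟨⟨fun x hx => ?_, fun v hv z hz => T.search_isPath _ hv hz, fun x hx => ?_,
    fun x hx => ?_, hcong _⟩, fun x hx => ?_, fun v hv z hz => T.search_isPath _ hv hz, hcong _⟩
  · have h1 : (T.space .table x : ℝ) ≤ 11 + 2 * Nat.clog 2 (T.width x.1) := by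
      exact_mod_cast T.space_table_le x
    have h2 := T.clog_width_le (T.mem_nodes.1 hx).1
    calc (T.space .table x : ℝ) ≤ 38 * Real.log T.N := by linarith
      _ ≤ _ := by gcongr; linarith
  · refine (h.expectedVisits_horizontal_table_le ha hb hx).trans ?_
    have hx0 : (0 : ℝ) ≤ x.1 := Nat.cast_nonneg _
    rcases T.row_cases hx with h1 | h1
    · rw [T.width_of_le h1, Nat.clog_pow _ _ (by norm_num)]
      calc K * (2 * ((x.1 : ℝ) + 1)) = 2 * K * (x.1 + 1) := by ring
        _ ≤ _ := by gcongr; linarith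
    · have h2 := T.clog_width_le (T.mem_nodes.1 hx).1
      have h3 := h.log_N_le hb
      have h4 : (T.height : ℝ) + 1 = x.1 := by rw [h1]; push_cast; ring
      rw [h4, ← hE] at h3
      have hE0 : 0 ≤ E := by positivity
      calc K * (2 * ((Nat.clog 2 (T.width x.1) : ℝ) + 1)) ≤ K * (2 * (8 * (E * (x.1 + 1)))) := by
            gcongr
            nlinarith
        _ = 16 * (K * E) * (x.1 + 1) := by ring
        _ ≤ _ := by gcongr; linarith
  · refine (h.expectedVisits_vertical_le ha hb hx).trans ?_
    linarith
  · have h1 : (T.space .hyper x : ℝ) ≤ 16 := by exact_mod_cast T.space_hyper_le x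
    linarith
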